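/- **Theorem 1.5.** Put $b_0 := \arctan\sqrt{8} = \arccos(1/3)$ and, for $t\in[0,\pi]$ and $k>0$, $$F_k(t) := \min\{k\,\operatorname{chd} t,\ \sqrt{\operatorname{chd} t}\,\},\qquad \operatorname{chd} t := 2\sin(t/2).$$ A *spherical triangle* is a geodesic triangle on the unit sphere of $\mathbb{R}^3$ whose angles all lie strictly between $0$ and $\pi$; its *circumscribed radius* is the spherical radius of the closed spherical disc that contains the triangle and whose boundary circle passes through its three vertices. For every $\varepsilon\in(0,b_0)$ there exist $k\ge 1$ and $\delta>0$ such that for every spherical triangle $\Delta$ of circumscribed radius at most $b_0-\varepsilon$ the following holds. Let $a,b,c$ be the side lengths of $\Delta$ and $\alpha,\beta,\gamma$ the angles opposite to them. Then there is a nondegenerate Euclidean triangle $\tilde\Delta$ with side lengths $F_k(a),F_k(b),F_k(c)$ (it is unique up to isometry), and its angles $\tilde\alpha,\tilde\beta,\tilde\gamma$ opposite to these sides satisfy $$\min\left\{\frac{\tilde\alpha}{\alpha},\frac{\tilde\beta}{\beta},\frac{\tilde\gamma}{\gamma}\right\}\ \ge\ \frac12+\delta .$$ -/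

import Mathlib

/-- Ambient Euclidean three-space; its unit sphere carries the spherical triangles. -/
abbrev Space3 : Type := EuclideanSpace ℝ (Fin 3)

/-- A (labelled) spherical triangle, given by its vertices on the unit sphere. The sides are the
minimal great-circle arcs. All three angles lie strictly between `0` and `π` exactly when the
vertices are linearly independent, that is, do not lie on a common great circle. -/
structure SphericalTriangle where
  vertex : Fin 3 → Space3
  norm_vertex : ∀ i, ‖vertex i‖ = 1
  linearIndependent : LinearIndependent ℝ vertex

/-- For unit vectors `x`, `y`: the component of `y` orthogonal to `x`. It is tangent to the sphere
at `x` and has the direction in which the minimal great-circle arc from `x` to `y` leaves `x`. -/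
noncomputable def tangentToward (x y : Space3) : Space3 := y - inner ℝ x y • x

namespace SphericalTriangle

/-- Length of the side opposite to vertex `i` (indices are modulo `3`): the spherical distance
between the other two vertices. -/
noncomputable def side (Δ : SphericalTriangle) (i : Fin 3) : ℝ :=
  InnerProductGeometry.angle (Δ.vertex (i + 1)) (Δ.vertex (i + 2))

/-- Angle at vertex `i`: the angle between the two sides that leave this vertex. -/
noncomputable def angle (Δ : SphericalTriangle) (i : Fin 3) : ℝ :=
  InnerProductGeometry.angle (tangentToward (Δ.vertex i) (Δ.vertex (i + 1)))
    (tangentToward (Δ.vertex i) (Δ.vertex (i + 2)))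

/-- The closed region of the sphere that is bounded by the three sides: the intersection of the
sphere with the convex cone that the vertices generate. -/
def region (Δ : SphericalTriangle) : Set Space3 :=
  {x | ‖x‖ = 1 ∧ ∃ c : Fin 3 → ℝ, (∀ i, 0 ≤ c i) ∧ x = ∑ i, c i • Δ.vertex i}

/-- `R` is the spherical radius of a closed spherical disc that contains the triangle and whose
boundary circle passes through the three vertices. -/
def IsCircumradius (Δ : SphericalTriangle) (R : ℝ) : Prop :=
  ∃ N : Space3, ‖N‖ = 1 ∧ (∀ i, InnerProductGeometry.angle N (Δ.vertex i) = R) ∧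
    ∀ x ∈ Δ.region, InnerProductGeometry.angle N x ≤ R

/-- The angles are strictly between `0` and `π`. -/
theorem angle_mem_Ioo (Δ : SphericalTriangle) (i : Fin 3) :
    Δ.angle i ∈ Set.Ioo 0 Real.pi := by
  have hli : ∀ a b c : ℝ, a • Δ.vertex i + b • Δ.vertex (i + 1) + c • Δ.vertex (i + 2) = 0 →
      b = 0 ∧ c = 0 := by
    intro a b c h
    have key := Fintype.linearIndependent_iff.1 Δ.linearIndependent
    fin_cases i
    · have := key ![a, b, c] (by simpa [Fin.sum_univ_three] using h)
      exact ⟨this 1, this 2⟩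
    · have := key ![c, a, b] (by
        simp [Fin.sum_univ_three] at h ⊢
        rw [← h]; abel)
      exact ⟨this 2, this 0⟩
    · have := key ![b, c, a] (by
        simp [Fin.sum_univ_three] at h ⊢
        rw [← h]; abel)
      exact ⟨this 0, this 1⟩
  have hcomb : ∀ b c : ℝ, b • tangentToward (Δ.vertex i) (Δ.vertex (i + 1)) +
      c • tangentToward (Δ.vertex i) (Δ.vertex (i + 2)) = 0 → b = 0 ∧ c = 0 := by
    intro b c h
    apply hli (-(b * inner ℝ (Δ.vertex i) (Δ.vertex (i + 1))
      + c * inner ℝ (Δ.vertex i) (Δ.vertex (i + 2)))) b c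
    rw [← h]
    unfold tangentToward
    module
  refine ⟨lt_of_le_of_ne (InnerProductGeometry.angle_nonneg _ _) fun h0 => ?_,
    lt_of_le_of_ne (InnerProductGeometry.angle_le_pi _ _) fun hpi => ?_⟩
  · obtain ⟨-, r, -, hr⟩ := InnerProductGeometry.angle_eq_zero_iff.1 h0.symm
    have := (hcomb r (-1) (by rw [hr]; module)).2
    norm_num at this
  · obtain ⟨-, r, -, hr⟩ := InnerProductGeometry.angle_eq_pi_iff.1 hpi
    have := (hcomb r (-1) (by rw [hr]; module)).2
    norm_num at this

theorem exists_isCircumradius (Δ : SphericalTriangle) : ∃ R, Δ.IsCircumradius R := by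
  let b := basisOfLinearIndependentOfCardEqFinrank Δ.linearIndependent (by simp)
  have hb : ∀ i, b i = Δ.vertex i := fun i => by simp [b]
  let f : Space3 →L[ℝ] ℝ := LinearMap.toContinuousLinearMap (b.constr ℝ fun _ => (1 : ℝ))
  have hf : ∀ i, f (Δ.vertex i) = 1 := fun i => by
    rw [← hb]; simp [f]
  let n : Space3 := (InnerProductSpace.toDual ℝ Space3).symm f
  have hn : ∀ x, inner ℝ n x = f x := fun x => by simp [n]
  have hn0 : n ≠ 0 := fun h => by
    have := hn (Δ.vertex 0)
    rw [hf, h] at this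
    simp at this
  have hpos : 0 < ‖n‖ := norm_pos_iff.2 hn0
  have hN : ‖(‖n‖⁻¹ : ℝ) • n‖ = 1 := by
    rw [norm_smul, norm_inv, norm_norm, inv_mul_cancel₀ hpos.ne']
  refine ⟨Real.arccos ‖n‖⁻¹, (‖n‖⁻¹ : ℝ) • n, hN, fun i => ?_, fun x hx => ?_⟩
  · unfold InnerProductGeometry.angle
    rw [hN, Δ.norm_vertex, real_inner_smul_left, hn, hf]
    simp
  · obtain ⟨hx1, c, hc, hxc⟩ := hx
    unfold InnerProductGeometry.angle
    rw [hN, hx1, real_inner_smul_left, hn]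
    apply Real.arccos_le_arccos
    have h1 : f x = ∑ i, c i := by rw [hxc]; simp [hf]
    have h2 : 1 ≤ ∑ i, c i := by
      rw [← hx1, hxc]
      refine (norm_sum_le _ _).trans (le_of_eq ?_)
      refine Finset.sum_congr rfl fun i _ => ?_
      rw [norm_smul, Δ.norm_vertex, mul_one, Real.norm_of_nonneg (hc i)]
    rw [h1]
    simp only [mul_one, div_one]
    exact le_mul_of_one_le_right (inv_nonneg.2 hpos.le) h2

/-- The circumscribed radius. -/
noncomputable def circumradius (Δ : SphericalTriangle) : ℝ :=
  Classical.choose Δ.exists_isCircumradius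

theorem IsCircumradius.cos_nonneg {Δ : SphericalTriangle} {R : ℝ} (h : Δ.IsCircumradius R) :
    0 ≤ Real.cos R := by
  obtain ⟨N, hN, hv, hreg⟩ := h
  have hin : ∀ i, inner ℝ N (Δ.vertex i) = Real.cos R := fun i => by
    rw [← hv i, InnerProductGeometry.cos_angle, hN, Δ.norm_vertex]; simp
  have hne : Δ.vertex 0 ≠ Δ.vertex 1 := fun h => by
    simpa using Δ.linearIndependent.injective h
  let m := Δ.vertex 0 + Δ.vertex 1
  have hm0 : m ≠ 0 := fun h => by
    have := Fintype.linearIndependent_iff.1 Δ.linearIndependent ![1, 1, 0]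
      (by simpa [Fin.sum_univ_three] using h) 0
    simp at this
  have hmpos : 0 < ‖m‖ := norm_pos_iff.2 hm0
  have hd : 0 < ‖Δ.vertex 0 - Δ.vertex 1‖ := norm_pos_iff.2 (sub_ne_zero.2 hne)
  have hpl := parallelogram_law_with_norm ℝ (Δ.vertex 0) (Δ.vertex 1)
  rw [Δ.norm_vertex, Δ.norm_vertex] at hpl
  have hmlt : ‖m‖ < 2 := by
    change ‖m‖ ^ 2 + _ = _ at hpl
    nlinarith
  have hx1 : ‖(‖m‖⁻¹ : ℝ) • m‖ = 1 := by
    rw [norm_smul, norm_inv, norm_norm, inv_mul_cancel₀ hmpos.ne']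
  have hx := hreg ((‖m‖⁻¹ : ℝ) • m) ⟨hx1, ![‖m‖⁻¹, ‖m‖⁻¹, 0],
    by intro i; fin_cases i <;> simp, by simp [Fin.sum_univ_three, m]⟩
  have hRpi : R ≤ Real.pi := by rw [← hv 0]; exact InnerProductGeometry.angle_le_pi _ _
  have hcos := Real.cos_le_cos_of_nonneg_of_le_pi (InnerProductGeometry.angle_nonneg _ _) hRpi hx
  rw [InnerProductGeometry.cos_angle, hN, hx1, inner_smul_right, inner_add_right, hin, hin] at hcos
  by_contra! hneg
  have : Real.cos R * ‖m‖ ≤ 2 * Real.cos R := by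
    have := mul_le_mul_of_nonneg_right hcos hmpos.le
    field_simp at this
    linarith
  nlinarith

theorem IsCircumradius.unique {Δ : SphericalTriangle} {R R' : ℝ} (h : Δ.IsCircumradius R)
    (h' : Δ.IsCircumradius R') : R = R' := by
  have h0 := h.cos_nonneg
  have h0' := h'.cos_nonneg
  obtain ⟨N, hN, hv, -⟩ := h
  obtain ⟨N', hN', hv', -⟩ := h'
  have hin : ∀ i, inner ℝ N (Δ.vertex i) = Real.cos R := fun i => by
    rw [← hv i, InnerProductGeometry.cos_angle, hN, Δ.norm_vertex]; simp
  have hin' : ∀ i, inner ℝ N' (Δ.vertex i) = Real.cos R' := fun i => by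
    rw [← hv' i, InnerProductGeometry.cos_angle, hN', Δ.norm_vertex]; simp
  let b := basisOfLinearIndependentOfCardEqFinrank Δ.linearIndependent (by simp)
  have hb : ∀ i, b i = Δ.vertex i := fun i => by simp [b]
  have key : Real.cos R' • N = Real.cos R • N' := by
    refine InnerProductSpace.ext_inner_right_basis b fun i => ?_
    rw [hb, real_inner_smul_left, real_inner_smul_left, hin, hin', mul_comm]
  have hc := congrArg norm key
  rw [norm_smul, norm_smul, hN, hN', Real.norm_of_nonneg h0, Real.norm_of_nonneg h0', mul_one,
    mul_one] at hc
  refine Real.injOn_cos ?_ ?_ hc.symm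
  · rw [← hv 0]; exact ⟨InnerProductGeometry.angle_nonneg _ _, InnerProductGeometry.angle_le_pi _ _⟩
  · rw [← hv' 0]; exact ⟨InnerProductGeometry.angle_nonneg _ _, InnerProductGeometry.angle_le_pi _ _⟩

/-- The circumscribed radius is the only number with its defining property. -/
theorem isCircumradius_iff (Δ : SphericalTriangle) (R : ℝ) :
    Δ.IsCircumradius R ↔ R = Δ.circumradius :=
  ⟨fun h => h.unique (Classical.choose_spec Δ.exists_isCircumradius),
    fun h => h ▸ Classical.choose_spec Δ.exists_isCircumradius⟩

end SphericalTriangle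

/-- A Euclidean triangle: three affinely independent points of the Euclidean plane. -/
abbrev EuclideanTriangle : Type := Affine.Triangle ℝ (EuclideanSpace ℝ (Fin 2))

namespace EuclideanTriangle

/-- Length of the side opposite to vertex `i` (indices are modulo `3`). -/
noncomputable def side (T : EuclideanTriangle) (i : Fin 3) : ℝ :=
  dist (T.points (i + 1)) (T.points (i + 2))

/-- Angle at vertex `i`. -/
noncomputable def angle (T : EuclideanTriangle) (i : Fin 3) : ℝ :=
  EuclideanGeometry.angle (T.points (i + 1)) (T.points i) (T.points (i + 2))

end EuclideanTriangle

/-- `T` is the transformed triangle `F Δ`: the Euclidean triangle (unique up to isometry) whose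
sides are the images under `F` of the corresponding sides of `Δ`. -/
def IsTransformedTriangle (F : ℝ → ℝ) (Δ : SphericalTriangle) (T : EuclideanTriangle) : Prop :=
  ∀ i, T.side i = F (Δ.side i)

/-- The least ratio of an angle of `T` to the corresponding angle of `Δ`. When `T` is the
transformed triangle `F Δ`, this is the angle distortion `D(F, Δ)`. -/
noncomputable def angleDistortion (Δ : SphericalTriangle) (T : EuclideanTriangle) : ℝ :=
  min (T.angle 0 / Δ.angle 0) (min (T.angle 1 / Δ.angle 1) (T.angle 2 / Δ.angle 2))

/-- The chord that subtends an arc of length `t` of the unit circle. -/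
noncomputable def chd (t : ℝ) : ℝ := 2 * Real.sin (t / 2)

/-- The side distortion function `F_k`. -/
noncomputable def sideDistortion (k t : ℝ) : ℝ := min (k * chd t) (√(chd t))

/-- The constant `b₀`, the circumscribed radius of the equilateral spherical triangle with all
angles `2π/3`. -/
noncomputable def b₀ : ℝ := Real.arctan (√8)

/-! Everything is expressed in the chords x, y, z of the sides: they form a Euclidean triangle of
circumradius sin R, and F_k depends on t only through chd t. Put ρ = cos R, so that ρ ≥ cos(b₀ - ε)
> 1/3. For a spherical angle α let A be the corresponding angle of the chord triangle and Q that of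
the triangle with sides √x, √y, √z. The equilateral triangle with ρ = 1/3 has α = 2π/3 and Q = π/3,
so b₀ is the radius at which Q = α/2 becomes possible.

For ρ > 1/3, `sqrtCosSq_mul_le` (α obtuse) and `mul_one_sub_sphericalCos_le` (α acute) compare Q
with α/2 with a definite gain, and `euclidCos_sqrt_le` turns this into Q ≥ (1/2 + δ)α as long as α
stays away from π. Near π the gain vanishes, but there the chords are so short that F_k is linear on
them, and the transformed angle is A, itself near π (`of_angle_near_pi`).

In general an angle of the transformed triangle is at least min(A, Q), by
`euclidCos_chordDistortion_le`. If A < (1/2 + δ)α, then a side adjacent to the angle has chord at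
least 1/2 (`euclidCos_le_of_small_sides`), and `euclidCos_chordDistortion_le_of_large` finishes by
direct estimates. The value k = 10 serves every ε; only δ depends on it. -/

/-! ### Chord triangles and their angles. -/

/-- The cosine of the angle opposite to the side `p` in a Euclidean triangle with sides
`p`, `q`, `w`. -/
noncomputable def euclidCos (p q w : ℝ) : ℝ := (q ^ 2 + w ^ 2 - p ^ 2) / (2 * q * w)

theorem euclidCos_comm (p q w : ℝ) : euclidCos p q w = euclidCos p w q := by
  unfold euclidCos
  rw [add_comm, mul_right_comm]

/-- Sixteen times the square of the area of a triangle with sides `x`, `y`, `z`. -/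
def heronProd (x y z : ℝ) : ℝ := (x + y + z) * (y + z - x) * (z + x - y) * (x + y - z)

/-- `x`, `y`, `z` are the sides of a Euclidean triangle inscribed in a small circle of the unit
sphere, whose spherical radius has cosine `ρ`. -/
structure InscribedChords (x y z ρ : ℝ) : Prop where
  pos₁ : 0 < x
  pos₂ : 0 < y
  pos₃ : 0 < z
  lt₁ : x < y + z
  lt₂ : y < z + x
  lt₃ : z < x + y
  cos_pos : 0 < ρ
  circum : heronProd x y z * (1 - ρ ^ 2) = (x * y * z) ^ 2

/-- The cosine of the angle opposite to the chord `x` in the spherical triangle with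
chords `x`, `y`, `z`. -/
noncomputable def sphericalCos (x y z : ℝ) : ℝ :=
  (euclidCos x y z - y * z / 4) / √((1 - y ^ 2 / 4) * (1 - z ^ 2 / 4))

theorem sphericalCos_comm (x y z : ℝ) : sphericalCos x y z = sphericalCos x z y := by
  unfold sphericalCos
  rw [euclidCos_comm, mul_comm y z, mul_comm (1 - y ^ 2 / 4)]

namespace InscribedChords

variable {x y z ρ : ℝ}

theorem swap (h : InscribedChords x y z ρ) : InscribedChords x z y ρ := by
  obtain ⟨h1, h2, h3, h4, h5, h6, h7, h8⟩ := h
  refine ⟨h1, h3, h2, by linarith, by linarith, by linarith, h7, ?_⟩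
  unfold heronProd at *
  linear_combination h8

theorem heronProd_pos (h : InscribedChords x y z ρ) : 0 < heronProd x y z := by
  obtain ⟨h1, h2, h3, h4, h5, h6, h7, h8⟩ := h
  unfold heronProd
  have := sub_pos.2 h4
  have := sub_pos.2 h5
  have := sub_pos.2 h6
  positivity

/-- Half a chord is at most the circumradius sin R of the chord triangle. The difference of the
squares is the squared distance from the circumcentre to the side, hence the perfect square. -/
theorem cos_sq_le (h : InscribedChords x y z ρ) : ρ ^ 2 ≤ 1 - y ^ 2 / 4 := by
  have hS := h.heronProd_pos
  have hc := h.circum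
  have key : heronProd x y z * (1 - y ^ 2 / 4 - ρ ^ 2) =
      (y * (x ^ 2 + z ^ 2 - y ^ 2) / 2) ^ 2 := by
    unfold heronProd at *
    linear_combination hc
  have : 0 ≤ 1 - y ^ 2 / 4 - ρ ^ 2 := by
    refine nonneg_of_mul_nonneg_right (a := heronProd x y z) ?_ hS
    rw [key]; positivity
  linarith

theorem prod_pos (h : InscribedChords x y z ρ) :
    0 < (1 - y ^ 2 / 4) * (1 - z ^ 2 / 4) := by
  have hρ : 0 < ρ ^ 2 := pow_pos h.cos_pos 2
  exact mul_pos (hρ.trans_le h.cos_sq_le) (hρ.trans_le h.swap.cos_sq_le)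

theorem cos_sq_le_sqrt (h : InscribedChords x y z ρ) :
    ρ ^ 2 ≤ √((1 - y ^ 2 / 4) * (1 - z ^ 2 / 4)) := by
  have hρ : 0 < ρ ^ 2 := pow_pos h.cos_pos 2
  apply Real.le_sqrt_of_sq_le
  rw [sq]
  exact mul_le_mul h.cos_sq_le h.swap.cos_sq_le hρ.le (hρ.le.trans h.cos_sq_le)

theorem four_mul_one_sub_sq (h : InscribedChords x y z ρ) :
    4 * (y * z) ^ 2 * (1 - euclidCos x y z ^ 2) = heronProd x y z := by
  have := h.pos₂; have := h.pos₃
  unfold euclidCos heronProd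
  field_simp
  ring

/-- This is the square of cos(b/2) cos(c/2) sin α = cos R sin A; both sides are the same multiple of
the volume spanned by the three vertices. -/
theorem sin_sq_identity (h : InscribedChords x y z ρ) :
    (1 - sphericalCos x y z ^ 2) * ((1 - y ^ 2 / 4) * (1 - z ^ 2 / 4)) =
      ρ ^ 2 * (1 - euclidCos x y z ^ 2) := by
  have hP := h.prod_pos
  have h4 := h.four_mul_one_sub_sq
  have hy := h.pos₂; have hz := h.pos₃
  have hc := h.circum
  unfold sphericalCos
  rw [div_pow, Real.sq_sqrt hP.le, sub_mul, div_mul_cancel₀ _ hP.ne', one_mul]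
  have hne : (4 * (y * z) ^ 2 : ℝ) ≠ 0 := by positivity
  apply mul_left_cancel₀ hne
  have e : 4 * (y * z) ^ 2 * (ρ ^ 2 * (1 - euclidCos x y z ^ 2)) =
      heronProd x y z - (x * y * z) ^ 2 := by
    rw [mul_left_comm, h4]; linarith
  rw [e]
  unfold euclidCos heronProd
  field_simp
  ring

/-- By the inequality of the means the square root is at most 1 - yz/4, which cancels the correction
yz/4 in the numerator of `sphericalCos`. -/
theorem one_sub_sphericalCos_le (h : InscribedChords x y z ρ) :
    (1 - sphericalCos x y z) * √((1 - y ^ 2 / 4) * (1 - z ^ 2 / 4)) ≤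
      1 - euclidCos x y z := by
  have hP := h.prod_pos
  have hs : 0 < √((1 - y ^ 2 / 4) * (1 - z ^ 2 / 4)) := Real.sqrt_pos.2 hP
  have hyz : 0 ≤ 1 - y * z / 4 := by
    nlinarith [h.cos_sq_le, h.swap.cos_sq_le, sq_nonneg (y - z), sq_nonneg ρ]
  have hle : √((1 - y ^ 2 / 4) * (1 - z ^ 2 / 4)) ≤ 1 - y * z / 4 := by
    apply Real.sqrt_le_iff.2 ⟨hyz, ?_⟩
    nlinarith [sq_nonneg (y - z)]
  unfold sphericalCos
  rw [sub_mul, div_mul_cancel₀ _ hs.ne']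
  linarith

theorem euclidCos_lt_one (h : InscribedChords x y z ρ) : euclidCos x y z < 1 := by
  have hy := h.pos₂; have hz := h.pos₃
  unfold euclidCos
  rw [div_lt_one (by positivity)]
  nlinarith [h.lt₂, h.lt₃, h.pos₁]

/-- The product of the cotangents of the two angles adjacent to `x`. -/
noncomputable def cotMul (x y z : ℝ) : ℝ :=
  (x ^ 2 + z ^ 2 - y ^ 2) * (x ^ 2 + y ^ 2 - z ^ 2) / heronProd x y z

/-- The square of the cotangent of the angle opposite to `y`. -/
noncomputable def cotSq (x y z : ℝ) : ℝ := (x ^ 2 + z ^ 2 - y ^ 2) ^ 2 / heronProd x y z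

theorem cotSq_mul (x y z : ℝ) : cotSq x y z * cotSq x z y = cotMul x y z ^ 2 := by
  have e : heronProd x z y = heronProd x y z := by unfold heronProd; ring
  unfold cotSq cotMul
  rw [e]
  ring

theorem cotSq_nonneg (h : InscribedChords x y z ρ) : 0 ≤ cotSq x y z :=
  div_nonneg (sq_nonneg _) h.heronProd_pos.le

theorem two_mul_cotMul_le (h : InscribedChords x y z ρ) :
    2 * cotMul x y z ≤ cotSq x y z + cotSq x z y := by
  have e : heronProd x z y = heronProd x y z := by unfold heronProd; ring
  unfold cotSq cotMul
  rw [e, ← mul_div_assoc, ← add_div]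
  refine div_le_div_of_nonneg_right ?_ h.heronProd_pos.le
  nlinarith [sq_nonneg (y ^ 2 - z ^ 2)]

/-- Let B, C be the other two angles of the chord triangle. The great circle from the vertex to the
centre of the disc splits α into two signed angles with tangents (cot B)/ρ and (cot C)/ρ; the
formula is the cosine of their sum. -/
theorem sphericalCos_eq (h : InscribedChords x y z ρ) :
    sphericalCos x y z = (ρ ^ 2 - cotMul x y z) /
      √((ρ ^ 2 + cotSq x y z) * (ρ ^ 2 + cotSq x z y)) := by
  have hS := h.heronProd_pos
  have hx := h.pos₁; have hy := h.pos₂; have hz := h.pos₃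
  have hc := h.circum
  have e : heronProd x z y = heronProd x y z := by unfold heronProd; ring
  have hσ : 0 < heronProd x y z / (4 * x ^ 2 * y * z) := by positivity
  have hρ : ρ ^ 2 = 1 - (x * y * z) ^ 2 / heronProd x y z := by
    field_simp; linarith
  have hW : euclidCos x y z - y * z / 4 =
      heronProd x y z / (4 * x ^ 2 * y * z) * (ρ ^ 2 - cotMul x y z) := by
    rw [hρ]
    unfold euclidCos cotMul
    field_simp
    unfold heronProd
    ring
  have h1 : 1 - y ^ 2 / 4 = heronProd x y z / (4 * x ^ 2 * z ^ 2) * (ρ ^ 2 + cotSq x y z) := by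
    rw [hρ]
    unfold cotSq
    field_simp
    unfold heronProd
    ring
  have h2 : 1 - z ^ 2 / 4 = heronProd x y z / (4 * x ^ 2 * y ^ 2) * (ρ ^ 2 + cotSq x z y) := by
    rw [hρ]
    unfold cotSq
    rw [e]
    field_simp
    unfold heronProd
    ring
  have hP : (1 - y ^ 2 / 4) * (1 - z ^ 2 / 4) = (heronProd x y z / (4 * x ^ 2 * y * z)) ^ 2 *
      ((ρ ^ 2 + cotSq x y z) * (ρ ^ 2 + cotSq x z y)) := by
    rw [h1, h2]
    field_simp
  unfold sphericalCos
  rw [hW, hP, Real.sqrt_mul (sq_nonneg _), Real.sqrt_sq hσ.le, mul_div_mul_left _ _ hσ.ne']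

/-! ### The square-root triangle against half the spherical angle. -/

/-- The square of the cosine of the angle opposite to `√x` in the triangle with sides
`√x`, `√y`, `√z`. -/
noncomputable def sqrtCosSq (x y z : ℝ) : ℝ := (y + z - x) ^ 2 / (4 * y * z)

/-- These quantities are invariant under scaling and under exchanging y and z, so two parameters
suffice. In terms of the tangent lengths l, g, k of the incircle, Y is the semiperimeter over l, and
d measures the asymmetry of g and k. The equilateral triangle is Y = 3, d = 1. -/
theorem exists_params (h : InscribedChords x y z ρ) : ∃ Y d : ℝ, 1 < Y ∧ 1 ≤ d ∧
    sqrtCosSq x y z = 2 * (1 + d) / (Y ^ 2 + 1 + 2 * Y * d) ∧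
    cotMul x y z = (Y ^ 2 + 1 - 2 * Y * d) / (4 * Y) ∧
    cotSq x y z + cotSq x z y = (Y ^ 2 + 1) * d / (2 * Y) - 1 := by
  obtain ⟨h1, h2, h3, h4, h5, h6, h7, -⟩ := h
  obtain ⟨l, hl⟩ : ∃ l, l = (y + z - x) / 2 := ⟨_, rfl⟩
  obtain ⟨g, hg⟩ : ∃ g, g = (z + x - y) / 2 := ⟨_, rfl⟩
  obtain ⟨k, hk⟩ : ∃ k, k = (x + y - z) / 2 := ⟨_, rfl⟩
  have hl0 : 0 < l := by linarith
  have hg0 : 0 < g := by linarith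
  have hk0 : 0 < k := by linarith
  obtain rfl : x = g + k := by linarith
  obtain rfl : y = l + k := by linarith
  obtain rfl : z = l + g := by linarith
  have hS : heronProd (g + k) (l + k) (l + g) = 16 * (l + g + k) * l * g * k := by
    unfold heronProd; ring
  have hS' : heronProd (g + k) (l + g) (l + k) = 16 * (l + g + k) * l * g * k := by
    unfold heronProd; ring
  refine ⟨(l + g + k) / l, (g ^ 2 + k ^ 2) / (2 * g * k), ?_, ?_, ?_, ?_, ?_⟩
  · rw [lt_div_iff₀ hl0]; linarith
  · rw [le_div_iff₀ (by positivity)]; nlinarith [sq_nonneg (g - k)]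
  · unfold sqrtCosSq
    field_simp
    ring
  · unfold cotMul
    rw [hS]
    field_simp
    ring
  · unfold cotSq
    rw [hS, hS']
    field_simp
    ring

/-- Equality holds for the equilateral triangle, whence the factor (Y - 3)² below. -/
theorem one_add_nine_mul_cotMul (h : InscribedChords x y z ρ) :
    (1 + 9 * cotMul x y z) * sqrtCosSq x y z ≤ 1 := by
  obtain ⟨Y, d, hY, hd, hq, ht, -⟩ := h.exists_params
  obtain ⟨e, rfl⟩ : ∃ e, d = 1 + e := ⟨d - 1, by ring⟩
  have he : 0 ≤ e := by linarith
  have key : 0 ≤ 2 * (Y - 1) * (Y - 3) ^ 2 + (-5 * Y ^ 2 + 50 * Y - 9) * e + 18 * Y * e ^ 2 := by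
    have hY1 : 0 ≤ Y - 1 := by linarith
    have h0 : 0 ≤ 2 * (Y - 1) * (Y - 3) ^ 2 := by positivity
    -- For Y ≤ 9 all coefficients in e are nonnegative; beyond that the outer two terms absorb the
    -- mixed one.
    by_cases h9 : Y ≤ 9
    · have : 0 ≤ (-5 * Y ^ 2 + 50 * Y - 9) := by nlinarith
      positivity
    · push Not at h9
      have h1 : 5 * Y * (Y - 3) * e ≤ 2 * (Y - 1) * (Y - 3) ^ 2 + 18 * Y * e ^ 2 := by
        have : 5 * Y * (Y - 3) * e ≤ Y * (Y - 3) ^ 2 + 7 * Y * e ^ 2 := by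
          have : 0 ≤ Y * ((Y - 3) ^ 2 - 5 * (Y - 3) * e + 7 * e ^ 2) := by
            apply mul_nonneg (by linarith)
            nlinarith [sq_nonneg (2 * (Y - 3) - 5 * e), sq_nonneg e]
          nlinarith
        nlinarith [sq_nonneg (Y - 3), mul_nonneg (by linarith : (0:ℝ) ≤ Y) (sq_nonneg e),
          mul_nonneg (by linarith : (0:ℝ) ≤ Y - 2) (sq_nonneg (Y - 3))]
      nlinarith [mul_nonneg (by nlinarith : (0:ℝ) ≤ 35 * Y - 9) he]
  rw [hq, ht]
  have hY0 : 0 < Y := by linarith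
  rw [show (1 + 9 * ((Y ^ 2 + 1 - 2 * Y * (1 + e)) / (4 * Y))) *
    (2 * (1 + (1 + e)) / (Y ^ 2 + 1 + 2 * Y * (1 + e))) =
    ((4 * Y + 9 * (Y ^ 2 + 1 - 2 * Y * (1 + e))) * (2 + e)) /
      (2 * Y * (Y ^ 2 + 1 + 2 * Y * (1 + e))) by field_simp; ring]
  rw [div_le_one (by positivity)]
  linarith

/-- For acute α the aim is (1 + κ/36) sin²(α/2) ≤ sin² Q. It is clear if cos² Q ≤ 1/3. The other
alternative is this inequality cleared of denominators, with the square root in `sphericalCos_eq`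
replaced by the arithmetic mean and ρ² by its lower bound (1 + κ)/9. -/
theorem sqrtCosSq_le_or (h : InscribedChords x y z ρ) {κ : ℝ} (hκ : 0 ≤ κ) (hκ1 : κ ≤ 1) :
    sqrtCosSq x y z ≤ 1 / 3 ∨
    (1 + κ / 36) * (cotSq x y z + cotSq x z y + 2 * cotMul x y z) / 2 ≤
    (1 - sqrtCosSq x y z) * (2 * (1 + κ) / 9 + (cotSq x y z + cotSq x z y)) := by
  obtain ⟨Y, d, hY, hd, hq, ht, hT⟩ := h.exists_params
  obtain ⟨e, rfl⟩ : ∃ e, d = 1 + e := ⟨d - 1, by ring⟩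
  have he : 0 ≤ e := by linarith
  have hY0 : 0 < Y := by linarith
  rw [hq, ht, hT]
  by_cases h3 : Y ≤ 3
  · right
    have e1 : (1 + κ / 36) * ((Y ^ 2 + 1) * (1 + e) / (2 * Y) - 1 +
        2 * ((Y ^ 2 + 1 - 2 * Y * (1 + e)) / (4 * Y))) / 2 =
        (1 + κ / 36) * (9 * (Y - 1) * (2 + e) * (Y ^ 2 + 1 + 2 * Y * (1 + e))) * (Y - 1) /
          (36 * Y * (Y ^ 2 + 1 + 2 * Y * (1 + e))) := by
      field_simp; ring
    have e2 : (1 - 2 * (1 + (1 + e)) / (Y ^ 2 + 1 + 2 * Y * (1 + e))) *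
        (2 * (1 + κ) / 9 + ((Y ^ 2 + 1) * (1 + e) / (2 * Y) - 1)) =
        ((8 * Y * (1 + κ) + 18 * ((Y ^ 2 + 1) * (1 + e) - 2 * Y)) * (Y + 3 + 2 * e)) * (Y - 1) /
          (36 * Y * (Y ^ 2 + 1 + 2 * Y * (1 + e))) := by
      field_simp; ring
    rw [e1, e2]
    refine div_le_div_of_nonneg_right ?_ (by positivity)
    refine mul_le_mul_of_nonneg_right ?_ (by linarith)
    have hb : 9 * (Y - 1) * (2 + e) * (Y ^ 2 + 1 + 2 * Y * (1 + e)) ≤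
        9 * 2 * (2 + e) * (16 + 6 * e) := by
      have : Y ^ 2 + 1 + 2 * Y * (1 + e) ≤ 16 + 6 * e := by nlinarith
      gcongr
      linarith
    have hid : (8 * Y * (1 + κ) + 18 * ((Y ^ 2 + 1) * (1 + e) - 2 * Y)) * (Y + 3 + 2 * e) =
        9 * (Y - 1) * (2 + e) * (Y ^ 2 + 1 + 2 * Y * (1 + e)) + 8 * (Y - 3) ^ 2 +
        (9 * Y ^ 3 + 45 * Y ^ 2 + 7 * Y + 99) * e + (18 * Y ^ 2 + 18 * Y + 36) * e ^ 2 +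
        8 * κ * (Y * (Y + 3 + 2 * e)) := by ring
    have h4 : 4 ≤ Y * (Y + 3 + 2 * e) := by nlinarith
    have h5 : 160 * e ≤ (9 * Y ^ 3 + 45 * Y ^ 2 + 7 * Y + 99) * e := by
      apply mul_le_mul_of_nonneg_right _ he
      nlinarith [one_le_pow₀ hY.le (n := 2), one_le_pow₀ hY.le (n := 3)]
    have h6 : 72 * e ^ 2 ≤ (18 * Y ^ 2 + 18 * Y + 36) * e ^ 2 := by
      apply mul_le_mul_of_nonneg_right _ (sq_nonneg e)
      nlinarith
    have h7 : κ * 4 ≤ κ * (Y * (Y + 3 + 2 * e)) := mul_le_mul_of_nonneg_left h4 hκ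
    have h8 := mul_le_mul_of_nonneg_left hb hκ
    have h9 : κ * e ≤ e := by nlinarith
    have h10 : κ * e ^ 2 ≤ e ^ 2 := by nlinarith [sq_nonneg e]
    rw [hid]
    nlinarith [sq_nonneg (Y - 3), sq_nonneg e]
  · left
    push Not at h3
    rw [div_le_div_iff₀ (by positivity) (by norm_num)]
    nlinarith

/-- The numerator in `sphericalCos_eq` is nonpositive, so the denominator may be shrunk to ρ² + cot
B cot C. This gives 1 + cos α ≥ 2ρ²/(ρ² + cot B cot C), which is compared with
`one_add_nine_mul_cotMul`. -/
theorem sqrtCosSq_mul_le (h : InscribedChords x y z ρ) {κ : ℝ} (hκ : 0 ≤ κ)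
    (hκρ : 1 + κ ≤ 9 * ρ ^ 2) (hα : sphericalCos x y z ≤ 0) :
    2 * (1 + κ / 2) * sqrtCosSq x y z ≤ 1 + sphericalCos x y z := by
  have hmain := h.one_add_nine_mul_cotMul
  have h2 := h.two_mul_cotMul_le
  have hp := cotSq_mul x y z
  have hn1 := h.cotSq_nonneg
  have hn2 := h.swap.cotSq_nonneg
  have hρ : 0 < ρ ^ 2 := pow_pos h.cos_pos 2
  have hPpos : 0 < (ρ ^ 2 + cotSq x y z) * (ρ ^ 2 + cotSq x z y) := by positivity
  rw [h.sphericalCos_eq] at hα ⊢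
  have hs := Real.sqrt_pos.2 hPpos
  have hW : ρ ^ 2 - cotMul x y z ≤ 0 := by
    by_contra! hc
    exact absurd hα (not_le.2 (div_pos hc hs))
  have hle : ρ ^ 2 + cotMul x y z ≤ √((ρ ^ 2 + cotSq x y z) * (ρ ^ 2 + cotSq x z y)) := by
    apply Real.le_sqrt_of_sq_le
    nlinarith
  set t := cotMul x y z
  have ht : 0 < ρ ^ 2 + t := by linarith
  have h3 : (ρ ^ 2 - t) / (ρ ^ 2 + t) ≤
      (ρ ^ 2 - t) / √((ρ ^ 2 + cotSq x y z) * (ρ ^ 2 + cotSq x z y)) := by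
    rw [div_le_div_iff₀ ht hs]
    nlinarith
  refine le_trans ?_ (add_le_add_right h3 1)
  have h4 : sqrtCosSq x y z ≤ 1 / (1 + 9 * t) := by
    rw [le_div_iff₀ (by linarith)]; linarith
  have h5 : 2 * (1 + κ / 2) * sqrtCosSq x y z ≤ 2 * (1 + κ / 2) * (1 / (1 + 9 * t)) := by
    gcongr
  refine h5.trans ?_
  rw [show 1 + (ρ ^ 2 - t) / (ρ ^ 2 + t) = 2 * ρ ^ 2 / (ρ ^ 2 + t) by field_simp; ring,
    mul_one_div, div_le_div_iff₀ (by linarith) ht]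
  nlinarith [mul_nonneg (by linarith : 0 ≤ t - ρ ^ 2) hκ,
    mul_nonneg (by linarith : (0:ℝ) ≤ 9 * ρ ^ 2 - (1 + κ)) (by linarith : 0 ≤ t)]

/-- Now the numerator is nonnegative, so the denominator is enlarged to the arithmetic mean. -/
theorem mul_one_sub_sphericalCos_le (h : InscribedChords x y z ρ) {κ : ℝ} (hκ : 0 ≤ κ)
    (hκ1 : κ ≤ 1) (hκρ : 1 + κ ≤ 9 * ρ ^ 2) (hα : 0 ≤ sphericalCos x y z) :
    (1 + κ / 36) * ((1 - sphericalCos x y z) / 2) ≤ 1 - sqrtCosSq x y z := by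
  rcases h.sqrtCosSq_le_or hκ hκ1 with h1 | h1
  · nlinarith
  have hp := cotSq_mul x y z
  have hn1 := h.cotSq_nonneg
  have hn2 := h.swap.cotSq_nonneg
  have hρ : 0 < ρ ^ 2 := pow_pos h.cos_pos 2
  have hPpos : 0 < (ρ ^ 2 + cotSq x y z) * (ρ ^ 2 + cotSq x z y) := by positivity
  rw [h.sphericalCos_eq] at hα ⊢
  have hs := Real.sqrt_pos.2 hPpos
  have hW : 0 ≤ ρ ^ 2 - cotMul x y z := by
    by_contra! hc
    exact absurd hα (not_le.2 (div_neg_of_neg_of_pos hc hs))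
  have hle : √((ρ ^ 2 + cotSq x y z) * (ρ ^ 2 + cotSq x z y)) ≤
      ρ ^ 2 + (cotSq x y z + cotSq x z y) / 2 := by
    apply Real.sqrt_le_iff.2 ⟨by positivity, ?_⟩
    nlinarith [sq_nonneg (cotSq x y z - cotSq x z y)]
  have hT : 0 < ρ ^ 2 + (cotSq x y z + cotSq x z y) / 2 := by positivity
  have h3 := div_le_div_of_nonneg_left hW hs hle
  set t := cotMul x y z
  set T := cotSq x y z + cotSq x z y
  have hq : 0 ≤ 1 - sqrtCosSq x y z := by
    by_contra! hc
    have h2 : 0 ≤ (1 + κ / 36) * (T + 2 * t) / 2 := by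
      have := h.heronProd_pos
      have hx := h.pos₁
      have e : heronProd x z y = heronProd x y z := by unfold heronProd; ring
      have : T + 2 * t = 4 * x ^ 4 / heronProd x y z := by
        simp only [T, t, cotSq, cotMul, e]
        field_simp
        ring
      rw [this]
      positivity
    have : 0 < 2 * (1 + κ) / 9 + T := by positivity
    nlinarith
  have h4 : (1 - sqrtCosSq x y z) * (2 * (1 + κ) / 9 + T) ≤
      (1 - sqrtCosSq x y z) * (2 * ρ ^ 2 + T) := by
    apply mul_le_mul_of_nonneg_left _ hq
    linarith
  have h5 : (1 - (ρ ^ 2 - t) / (ρ ^ 2 + T / 2)) = (T + 2 * t) / (2 * ρ ^ 2 + T) := by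
    have : 0 < 2 * ρ ^ 2 + T := by linarith
    have h7 : (ρ ^ 2 - t) / (ρ ^ 2 + T / 2) * (2 * ρ ^ 2 + T) = 2 * (ρ ^ 2 - t) := by
      rw [show 2 * ρ ^ 2 + T = 2 * (ρ ^ 2 + T / 2) by ring, mul_left_comm,
        div_mul_cancel₀ _ hT.ne']
    rw [eq_div_iff this.ne', sub_mul, h7]
    ring
  have h6 : (1 + κ / 36) * ((T + 2 * t) / (2 * ρ ^ 2 + T) / 2) ≤ 1 - sqrtCosSq x y z := by
    rw [div_div, ← mul_div_assoc, div_le_iff₀ (by linarith)]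
    linarith
  refine le_trans ?_ h6
  rw [← h5]
  gcongr

end InscribedChords

/-! ### The distortion of chords preserves the triangle inequality. -/

/-- `sideDistortion` as a function of the chord. -/
noncomputable def chordDistortion (k t : ℝ) : ℝ := min (k * t) √t

theorem chordDistortion_of_le {k t : ℝ} (ht : 0 ≤ t) (h : k ^ 2 * t ≤ 1) :
    chordDistortion k t = k * t := by
  apply min_eq_left
  apply Real.le_sqrt_of_sq_le
  nlinarith

theorem chordDistortion_of_ge {k t : ℝ} (hk : 0 < k) (ht : 0 ≤ t) (h : 1 ≤ k ^ 2 * t) :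
    chordDistortion k t = √t := by
  apply min_eq_right
  apply Real.sqrt_le_iff.2 ⟨by positivity, ?_⟩
  nlinarith

theorem chordDistortion_pos {k t : ℝ} (hk : 0 < k) (ht : 0 < t) : 0 < chordDistortion k t :=
  lt_min (by positivity) (Real.sqrt_pos.2 ht)

theorem chordDistortion_lt {k s t : ℝ} (hk : 0 < k) (hs : 0 ≤ s) (h : s < t) :
    chordDistortion k s < chordDistortion k t :=
  min_lt_min (by gcongr) (Real.sqrt_lt_sqrt hs h)

/-- The quotient of `chordDistortion k t` by t is nonincreasing in t, which yields subadditivity. -/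
theorem mul_chordDistortion_le {k s t : ℝ} (hs : 0 ≤ s) (h : s ≤ t) :
    s * chordDistortion k t ≤ t * chordDistortion k s := by
  unfold chordDistortion
  rw [mul_min_of_nonneg _ _ hs, mul_min_of_nonneg _ _ (hs.trans h)]
  apply min_le_min (by linarith)
  have h1 := Real.sqrt_le_sqrt h
  have h2 := mul_nonneg (mul_nonneg (Real.sqrt_nonneg s) (Real.sqrt_nonneg t)) (sub_nonneg.2 h1)
  have e1 := Real.sq_sqrt hs
  have e2 := Real.sq_sqrt (hs.trans h)
  have e : t * √s - s * √t = √s * √t * (√t - √s) := by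
    linear_combination (-√s) * e2 + √t * e1
  linarith

theorem chordDistortion_add_le {k s t : ℝ} (hs : 0 < s) (ht : 0 < t) :
    chordDistortion k (s + t) ≤ chordDistortion k s + chordDistortion k t := by
  have h1 := mul_chordDistortion_le (k := k) hs.le (by linarith : s ≤ s + t)
  have h2 := mul_chordDistortion_le (k := k) ht.le (by linarith : t ≤ s + t)
  refine le_of_mul_le_mul_left ?_ (by linarith : 0 < s + t)
  linarith

theorem chordDistortion_triangle {k x y z : ℝ} (hk : 0 < k) (hx : 0 < x) (hy : 0 < y)
    (hz : 0 < z) (h : x < y + z) :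
    chordDistortion k x < chordDistortion k y + chordDistortion k z :=
  (chordDistortion_lt hk hx.le h).trans_le (chordDistortion_add_le hy hz)

theorem euclidCos_mul {k x y z : ℝ} (hk : 0 < k) :
    euclidCos (k * x) (k * y) (k * z) = euclidCos x y z := by
  unfold euclidCos
  rw [show (k * y) ^ 2 + (k * z) ^ 2 - (k * x) ^ 2 = k ^ 2 * (y ^ 2 + z ^ 2 - x ^ 2) by ring,
    show 2 * (k * y) * (k * z) = k ^ 2 * (2 * y * z) by ring,
    mul_div_mul_left _ _ (by positivity)]

/-! ### Mixed linear and square-root sides: chords p², q², w², with the change of regime at kp = 1.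
-/

section Interpolation

variable {k p q w : ℝ}

/-- Over the common denominator 2qw, the claim reduces to k(q + w) ≥ 1. The factor k²qw is kept
because it later outweighs the factor 9 in `one_sub_cos_le`. -/
theorem mul_one_sub_euclidCos_le (hk : 0 < k) (hq : 0 < q) (hw : 0 < w) (hkq : 1 ≤ k * q) :
    k ^ 2 * (q * w) * (1 - euclidCos (p ^ 2) (q ^ 2) (w ^ 2)) ≤
      1 - euclidCos (k * p ^ 2) q w := by
  unfold euclidCos
  have e1 : k ^ 2 * (q * w) * (1 - ((q ^ 2) ^ 2 + (w ^ 2) ^ 2 - (p ^ 2) ^ 2) /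
      (2 * q ^ 2 * w ^ 2)) = k ^ 2 * (p ^ 4 - (q ^ 2 - w ^ 2) ^ 2) / (2 * q * w) := by
    field_simp; ring
  have e2 : 1 - (q ^ 2 + w ^ 2 - (k * p ^ 2) ^ 2) / (2 * q * w) =
      (k ^ 2 * p ^ 4 - (q - w) ^ 2) / (2 * q * w) := by
    field_simp; ring
  rw [e1, e2]
  refine div_le_div_of_nonneg_right ?_ (by positivity)
  have h1 : 1 ≤ k * (q + w) := by nlinarith
  have h2 : 1 ≤ (k * (q + w)) ^ 2 := one_le_pow₀ h1
  nlinarith [mul_le_mul_of_nonneg_right h2 (sq_nonneg (q - w))]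

/-- The cosine is P/μ + Nμ at μ = kw, which lies between 1 and w/q. The value at w/q is cos Q; the
value at 1 is P + N, at most cos A when P ≥ 0. The sign of N - P/μ decides which endpoint dominates;
for P < 0 the function increases and w/q does. -/
theorem euclidCos_le_max_of_small_adjacent (hk : 0 < k) (hq : 0 < q) (hw : 0 < w)
    (hkq : k * q ≤ 1) (hkw : 1 ≤ k * w) :
    euclidCos p (k * q ^ 2) w ≤ max (euclidCos (p ^ 2) (q ^ 2) (w ^ 2)) (euclidCos p q w) := by
  obtain ⟨P, hP⟩ : ∃ P, P = (w ^ 2 - p ^ 2) / (2 * q ^ 2) := ⟨_, rfl⟩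
  obtain ⟨N, hN⟩ : ∃ N, N = q ^ 2 / (2 * w ^ 2) := ⟨_, rfl⟩
  have hN0 : 0 < N := by rw [hN]; positivity
  have hwq : k * w ≤ w / q := by
    rw [le_div_iff₀ hq]; nlinarith
  have e1 : euclidCos p (k * q ^ 2) w = P / (k * w) + N * (k * w) := by
    rw [hP, hN]; unfold euclidCos; field_simp; ring
  have e2 : euclidCos p q w = P / (w / q) + N * (w / q) := by
    rw [hP, hN]; unfold euclidCos; field_simp; ring
  have e3 : euclidCos (p ^ 2) (q ^ 2) (w ^ 2) = P * (1 + p ^ 2 / w ^ 2) + N := by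
    rw [hP, hN]; unfold euclidCos; field_simp; ring
  rw [e1, e2, e3]
  set μ := k * w
  set ν := w / q
  have hμ : 0 < μ := by linarith
  have hν : 0 < ν := by linarith
  have d2 : P / μ + N * μ - (P / ν + N * ν) = (μ - ν) * (N - P / μ / ν) := by
    field_simp; ring
  by_cases hc : 0 ≤ P ∧ N ≤ P / μ
  · apply le_max_of_le_left
    have d1 : P / μ + N * μ - (P + N) = (μ - 1) * (N - P / μ) := by
      field_simp; ring
    have h1 : (μ - 1) * (N - P / μ) ≤ 0 :=
      mul_nonpos_of_nonneg_of_nonpos (by linarith) (by linarith)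
    have h2 : 0 ≤ P * (p ^ 2 / w ^ 2) := mul_nonneg hc.1 (by positivity)
    linarith
  · apply le_max_of_le_right
    have h3 : P / μ / ν ≤ N := by
      rcases lt_or_ge P 0 with h | h
      · have : P / μ / ν < 0 := div_neg_of_neg_of_pos (div_neg_of_neg_of_pos h hμ) hν
        linarith
      · have h4 : P / μ < N := by
          by_contra! h5; exact hc ⟨h, h5⟩
        refine le_trans ?_ h4.le
        exact div_le_self (by positivity) (by linarith)
    have h1 : (μ - ν) * (N - P / μ / ν) ≤ 0 :=
      mul_nonpos_of_nonpos_of_nonneg (by linarith) (by linarith)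
    linarith

theorem euclidCos_le_of_large_adjacent (hk : 0 < k) (hq : 0 < q) (hw : 0 < w)
    (hkq : k * q ≤ 1) (hkw : 1 ≤ k * w) :
    euclidCos (k * p ^ 2) (k * q ^ 2) w ≤ euclidCos (p ^ 2) (q ^ 2) (w ^ 2) := by
  have hqw : q ≤ w := le_of_mul_le_mul_left (hkq.trans hkw) hk
  have h1 : k * (q ^ 4 - p ^ 4) ≤ w ^ 3 := by
    have h2 : q ^ 3 ≤ w ^ 3 := by gcongr
    have h3 : (k * q) * q ^ 3 ≤ 1 * q ^ 3 := by gcongr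
    have h4 : 0 ≤ k * p ^ 4 := by positivity
    nlinarith
  have h5 : 0 ≤ (k * w - 1) * (w ^ 3 - k * (q ^ 4 - p ^ 4)) :=
    mul_nonneg (by linarith) (by linarith)
  have e : euclidCos (p ^ 2) (q ^ 2) (w ^ 2) - euclidCos (k * p ^ 2) (k * q ^ 2) w =
      (k * w - 1) * (w ^ 3 - k * (q ^ 4 - p ^ 4)) / (2 * k * q ^ 2 * w ^ 2) := by
    unfold euclidCos; field_simp; ring
  have : 0 ≤ (k * w - 1) * (w ^ 3 - k * (q ^ 4 - p ^ 4)) / (2 * k * q ^ 2 * w ^ 2) := by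
    positivity
  linarith

theorem euclidCos_le_of_large_opposite (hk : 0 < k) (hq : 0 < q) (hw : 0 < w)
    (hkp : 1 ≤ k * p) (hkq : k * q ≤ 1) (hkw : k * w ≤ 1) :
    euclidCos p (k * q ^ 2) (k * w ^ 2) ≤ euclidCos p q w := by
  obtain ⟨a, ha⟩ : ∃ a, a = k * q := ⟨_, rfl⟩
  obtain ⟨b, hb⟩ : ∃ b, b = k * w := ⟨_, rfl⟩
  obtain ⟨c, hc⟩ : ∃ c, c = k * p := ⟨_, rfl⟩
  rw [← ha] at hkq
  rw [← hb] at hkw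
  rw [← hc] at hkp
  have ha0 : 0 < a := by rw [ha]; positivity
  have hb0 : 0 < b := by rw [hb]; positivity
  have hab : a * b ≤ 1 := mul_le_one₀ hkq hb0.le hkw
  have h1 : |a - b| ≤ 1 - a * b := by
    apply abs_le_of_sq_le_sq _ (by linarith)
    nlinarith [mul_nonneg (by nlinarith : 0 ≤ 1 - a ^ 2) (by nlinarith : 0 ≤ 1 - b ^ 2)]
  have h2 : |a ^ 3 - b ^ 3| ≤ 1 := by
    have := pow_le_one₀ ha0.le hkq (n := 3)
    have := pow_le_one₀ hb0.le hkw (n := 3)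
    have : 0 < a ^ 3 := by positivity
    have : 0 < b ^ 3 := by positivity
    rw [abs_le]; constructor <;> linarith
  have h3 : (a ^ 3 - b ^ 3) * (a - b) ≤ 1 - a * b := by
    calc _ ≤ |(a ^ 3 - b ^ 3) * (a - b)| := le_abs_self _
      _ = |a ^ 3 - b ^ 3| * |a - b| := abs_mul _ _
      _ ≤ 1 * (1 - a * b) := by gcongr
      _ = _ := one_mul _
  have h4 : 0 ≤ (c ^ 2 - 1) * (1 - a * b) := mul_nonneg (by nlinarith) (by linarith)
  have e : euclidCos p q w - euclidCos p (k * q ^ 2) (k * w ^ 2) =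
      (c ^ 2 * (1 - a * b) - (a ^ 3 - b ^ 3) * (a - b)) / (2 * k ^ 4 * q ^ 2 * w ^ 2) := by
    rw [ha, hb, hc]; unfold euclidCos; field_simp; ring
  have : 0 ≤ (c ^ 2 * (1 - a * b) - (a ^ 3 - b ^ 3) * (a - b)) / (2 * k ^ 4 * q ^ 2 * w ^ 2) := by
    apply div_nonneg _ (by positivity)
    linarith
  linarith

end Interpolation

theorem le_one_or_one_le_of_sq {k p : ℝ} (hk : 0 < k) (hp : 0 < p) :
    (k * p ≤ 1 ∧ chordDistortion k (p ^ 2) = k * p ^ 2) ∨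
      (1 ≤ k * p ∧ chordDistortion k (p ^ 2) = p) := by
  rcases le_total (k * p) 1 with h | h
  · refine Or.inl ⟨h, chordDistortion_of_le (by positivity) ?_⟩
    rw [← mul_pow]; exact pow_le_one₀ (by positivity) h
  · refine Or.inr ⟨h, ?_⟩
    rw [chordDistortion_of_ge hk (by positivity), Real.sqrt_sq hp.le]
    rw [← mul_pow]; exact one_le_pow₀ h

/-- An angle of the transformed triangle is at least the smaller one of the corresponding angles
of the chord triangle and of the triangle obtained by taking square roots. -/
theorem euclidCos_chordDistortion_le {k x y z : ℝ} (hk : 0 < k) (hx : 0 < x) (hy : 0 < y)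
    (hz : 0 < z) (hx' : x < y + z) (hy' : y < z + x) (hz' : z < x + y) :
    euclidCos (chordDistortion k x) (chordDistortion k y) (chordDistortion k z) ≤
      max (euclidCos x y z) (euclidCos √x √y √z) := by
  obtain ⟨p, hp, rfl⟩ : ∃ p, 0 < p ∧ x = p ^ 2 :=
    ⟨√x, Real.sqrt_pos.2 hx, (Real.sq_sqrt hx.le).symm⟩
  obtain ⟨q, hq, rfl⟩ : ∃ q, 0 < q ∧ y = q ^ 2 :=
    ⟨√y, Real.sqrt_pos.2 hy, (Real.sq_sqrt hy.le).symm⟩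
  obtain ⟨w, hw, rfl⟩ : ∃ w, 0 < w ∧ z = w ^ 2 :=
    ⟨√z, Real.sqrt_pos.2 hz, (Real.sq_sqrt hz.le).symm⟩
  rw [Real.sqrt_sq hp.le, Real.sqrt_sq hq.le, Real.sqrt_sq hw.le]
  rcases le_one_or_one_le_of_sq hk hp with ⟨h1, e1⟩ | ⟨h1, e1⟩ <;>
  rcases le_one_or_one_le_of_sq hk hq with ⟨h2, e2⟩ | ⟨h2, e2⟩ <;>
  rcases le_one_or_one_le_of_sq hk hw with ⟨h3, e3⟩ | ⟨h3, e3⟩ <;>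
  rw [e1, e2, e3]
  · rw [euclidCos_mul hk]; exact le_max_left _ _
  · exact le_max_of_le_left (euclidCos_le_of_large_adjacent hk hq hw h2 h3)
  · rw [euclidCos_comm, euclidCos_comm (p ^ 2)]
    exact le_max_of_le_left (euclidCos_le_of_large_adjacent hk hw hq h3 h2)
  · apply le_max_of_le_left
    have h4 := mul_one_sub_euclidCos_le (p := p) hk hq hw h2
    have h5 : 1 ≤ k ^ 2 * (q * w) := by nlinarith
    have h6 : euclidCos (p ^ 2) (q ^ 2) (w ^ 2) ≤ 1 := by
      unfold euclidCos
      rw [div_le_one (by positivity)]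
      nlinarith
    nlinarith
  · exact le_max_of_le_right (euclidCos_le_of_large_opposite hk hq hw h1 h2 h3)
  · exact euclidCos_le_max_of_small_adjacent hk hq hw h2 h3
  · rw [euclidCos_comm, euclidCos_comm (p ^ 2), euclidCos_comm p q]
    exact euclidCos_le_max_of_small_adjacent hk hw hq h3 h2
  · exact le_max_right _ _

/-! ### Quantitative bounds for one angle, with k = 10. -/

theorem sin_mul_le_mul_sin {c x : ℝ} (hc : 1 ≤ c) (hx : 0 ≤ x) (hcx : c * x ≤ Real.pi) :
    Real.sin (c * x) ≤ c * Real.sin x := by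
  have hc0 : 0 < c := by linarith
  have h0 : (0 : ℝ) ∈ Set.Icc 0 Real.pi := ⟨le_rfl, Real.pi_pos.le⟩
  have h1 : c * x ∈ Set.Icc 0 Real.pi := ⟨by positivity, hcx⟩
  have hi : 0 ≤ 1 - c⁻¹ := by
    have := inv_le_one_of_one_le₀ hc
    linarith
  have h := strictConcaveOn_sin_Icc.concaveOn.2 h0 h1 hi (by positivity : 0 ≤ c⁻¹) (by ring)
  simp only [smul_eq_mul, mul_zero, Real.sin_zero, zero_add] at h
  rw [inv_mul_cancel_left₀ hc0.ne'] at h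
  rwa [inv_mul_le_iff₀ hc0] at h

namespace InscribedChords

variable {x y z ρ α : ℝ}

theorem one_sub_cos_le (h : InscribedChords x y z ρ) (hρ : 1 / 3 ≤ ρ)
    (hα : Real.cos α = sphericalCos x y z) : 1 - Real.cos α ≤ 9 * (1 - euclidCos x y z) := by
  have h1 := h.one_sub_sphericalCos_le
  have h2 := h.cos_sq_le_sqrt
  have h3 : 1 / 9 ≤ √((1 - y ^ 2 / 4) * (1 - z ^ 2 / 4)) := by nlinarith
  rw [← hα] at h1
  nlinarith [Real.cos_le_one α]

/-- Since ρ² ≥ 1/9, a small sin α forces a small sin A, and `one_sub_cos_le` keeps A away from 0, so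
A is near π. Then x is at most 2 sin A, and it is the longest side because A is obtuse. -/
theorem of_angle_near_pi (h : InscribedChords x y z ρ) (hρ : 1 / 3 ≤ ρ)
    (hα : Real.cos α = sphericalCos x y z) (hαpi : α ≤ Real.pi)
    (hα1 : Real.pi - 1 / 1000 < α) :
    euclidCos x y z ≤ -(8 / 9) ∧ x ≤ 1 / 100 ∧ y ≤ 1 / 100 ∧ z ≤ 1 / 100 := by
  have hx := h.pos₁; have hy := h.pos₂; have hz := h.pos₃
  have hsin := h.sin_sq_identity
  have h9 := h.one_sub_cos_le hρ hα
  rw [← hα, ← Real.sin_sq] at hsin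
  have hs0 : 0 ≤ Real.sin α := Real.sin_nonneg_of_nonneg_of_le_pi
    (by linarith [Real.pi_gt_three]) hαpi
  have hs1 : Real.sin α ≤ 1 / 1000 := by
    rw [← Real.sin_pi_sub]
    exact (Real.sin_le (by linarith)).trans (by linarith)
  have hs2 : Real.sin α ^ 2 ≤ 1 / 1000000 := by nlinarith
  have hP1 : (1 - y ^ 2 / 4) * (1 - z ^ 2 / 4) ≤ 1 := by
    have := h.cos_sq_le; have := h.swap.cos_sq_le
    apply mul_le_one₀ <;> nlinarith
  have hA : 1 - euclidCos x y z ^ 2 ≤ 9 / 1000000 := by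
    have h1 : Real.sin α ^ 2 * ((1 - y ^ 2 / 4) * (1 - z ^ 2 / 4)) ≤ 1 / 1000000 * 1 :=
      mul_le_mul hs2 hP1 h.prod_pos.le (by norm_num)
    have h2 : 1 / 9 ≤ ρ ^ 2 := by nlinarith
    by_contra! hc
    nlinarith
  have hcos : Real.cos α ≤ 0 :=
    Real.cos_nonpos_of_pi_div_two_le_of_le (by linarith [Real.pi_gt_three])
      (by linarith [Real.pi_pos])
  have hC : euclidCos x y z ≤ -(8 / 9) := by
    have h1 : euclidCos x y z ≤ 8 / 9 := by linarith
    by_contra! h2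
    nlinarith
  have hx2 : x ≤ 1 / 100 := by
    have h4 := h.four_mul_one_sub_sq
    have hS := h.heronProd_pos
    have h5 : (x * y * z) ^ 2 ≤ heronProd x y z := by
      rw [← h.circum]; nlinarith [sq_nonneg ρ]
    rw [← h4] at h5
    have h6 : x ^ 2 ≤ 4 * (1 - euclidCos x y z ^ 2) := by
      have : (y * z) ^ 2 * x ^ 2 ≤ (y * z) ^ 2 * (4 * (1 - euclidCos x y z ^ 2)) := by linarith
      exact le_of_mul_le_mul_left this (by positivity)
    nlinarith
  have hlt : y ^ 2 + z ^ 2 < x ^ 2 := by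
    have : euclidCos x y z < 0 := by linarith
    unfold euclidCos at this
    rw [div_lt_iff₀ (by positivity)] at this
    linarith
  refine ⟨hC, hx2, ?_, ?_⟩
  · nlinarith
  · nlinarith

theorem euclidCos_sqrt_le (h : InscribedChords x y z ρ) {κ δ : ℝ} (hκ : 0 < κ)
    (hκ1 : κ ≤ 1) (hκρ : 1 + κ ≤ 9 * ρ ^ 2) (hα : Real.cos α = sphericalCos x y z)
    (hα0 : 0 < α) (hα1 : α ≤ Real.pi - 1 / 1000) (hδ : 0 < δ) (hδ1 : δ ≤ 1 / 10000)
    (hδκ : 8 * δ ≤ Real.sin (1 / 2000) ^ 2 * κ / 36) :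
    euclidCos √x √y √z ≤ Real.cos ((1 / 2 + δ) * α) := by
  have hx := h.pos₁; have hy := h.pos₂; have hz := h.pos₃
  have hsq : euclidCos √x √y √z ^ 2 = sqrtCosSq x y z := by
    unfold euclidCos sqrtCosSq
    rw [Real.sq_sqrt hx.le, Real.sq_sqrt hy.le, Real.sq_sqrt hz.le, div_pow]
    congr 1
    rw [mul_pow, mul_pow, Real.sq_sqrt hy.le, Real.sq_sqrt hz.le]
    norm_num
  have hpi := Real.pi_gt_three
  have hpi' := Real.pi_lt_four
  have hs0 : 0 < Real.sin (1 / 2000) := Real.sin_pos_of_pos_of_lt_pi (by norm_num) (by linarith)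
  have hs1 : Real.sin (1 / 2000) ^ 2 ≤ 1 := by nlinarith [Real.sin_le_one (1 / 2000)]
  have hs2 : 0 < Real.sin (1 / 2000) ^ 2 := by positivity
  -- The relative gain c serves both cases; sin(1/2000) bounds cos(α/2) from below for α ≤ π -
  -- 1/1000.
  obtain ⟨c, hc⟩ : ∃ c, c = Real.sin (1 / 2000) ^ 2 * κ / 36 := ⟨_, rfl⟩
  have hc0 : 0 < c := by rw [hc]; positivity
  have hhalf : (1 - Real.cos α) / 2 = Real.sin (α / 2) ^ 2 := by
    rw [Real.sin_sq_eq_half_sub]; ring_nf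
  have hhalf' : (1 + Real.cos α) / 2 = Real.cos (α / 2) ^ 2 := by
    rw [Real.cos_sq]; ring_nf
  have hcossin : Real.sin (1 / 2000) ^ 2 ≤ Real.cos (α / 2) ^ 2 := by
    have : Real.sin (1 / 2000) ≤ Real.cos (α / 2) := by
      rw [← Real.cos_pi_div_two_sub]
      apply Real.cos_le_cos_of_nonneg_of_le_pi <;> linarith
    gcongr
  have hone := Real.sin_sq_add_cos_sq (α / 2)
  have hsin0 : 0 ≤ Real.sin (α / 2) :=
    Real.sin_nonneg_of_nonneg_of_le_pi (by linarith) (by linarith)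
  have hgap : (1 + c) * Real.sin (α / 2) ^ 2 ≤ 1 - sqrtCosSq x y z := by
    rcases le_total (Real.cos α) 0 with h0 | h0
    · rw [hα] at h0
      have h1 := h.sqrtCosSq_mul_le hκ.le hκρ h0
      rw [← hα] at h1
      have h2 : (1 + κ / 2) * sqrtCosSq x y z ≤ Real.cos (α / 2) ^ 2 := by linarith
      set C := Real.cos (α / 2) ^ 2
      have h3 : (1 + κ / 2) * (1 - κ / 3) ≥ 1 := by nlinarith
      have h4 : sqrtCosSq x y z ≤ (1 - κ / 3) * C := by
        have hC : 0 ≤ C := sq_nonneg _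
        have : sqrtCosSq x y z * (1 + κ / 2) ≤ (1 - κ / 3) * C * (1 + κ / 2) := by
          have := mul_le_mul_of_nonneg_right h3 hC
          linarith
        exact le_of_mul_le_mul_right this (by linarith)
      have h5 : c ≤ κ / 3 * C := by
        rw [hc]
        have := mul_le_mul_of_nonneg_left hcossin hκ.le
        have := mul_pos hs2 hκ
        linarith
      have h6 : c * Real.sin (α / 2) ^ 2 ≤ c * 1 :=
        mul_le_mul_of_nonneg_left (Real.sin_sq_le_one _) hc0.le
      linarith
    · rw [hα] at h0
      have h1 := h.mul_one_sub_sphericalCos_le hκ.le hκ1 hκρ h0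
      rw [← hα, hhalf] at h1
      have h2 : c ≤ κ / 36 := by
        rw [hc]
        have := mul_le_mul_of_nonneg_right hs1 hκ.le
        linarith
      have h3 := mul_le_mul_of_nonneg_right h2 (sq_nonneg (Real.sin (α / 2)))
      linarith
  have hθ : (1 / 2 + δ) * α = (1 + 2 * δ) * (α / 2) := by ring
  have hθ1 : (1 + 2 * δ) * (α / 2) ≤ Real.pi / 2 := by nlinarith
  have hsinθ := sin_mul_le_mul_sin (c := 1 + 2 * δ) (x := α / 2) (by linarith)
    (by linarith) (by linarith)
  have hsinθ0 : 0 ≤ Real.sin ((1 + 2 * δ) * (α / 2)) :=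
    Real.sin_nonneg_of_nonneg_of_le_pi (by positivity) (by linarith)
  rw [hθ]
  have hcosθ : 0 ≤ Real.cos ((1 + 2 * δ) * (α / 2)) :=
    Real.cos_nonneg_of_neg_pi_div_two_le_of_le (by
      have : 0 < (1 + 2 * δ) * (α / 2) := by positivity
      linarith) hθ1
  refine le_trans (le_abs_self _) (abs_le_of_sq_le_sq ?_ hcosθ)
  rw [hsq, Real.cos_sq']
  have h6 : Real.sin ((1 + 2 * δ) * (α / 2)) ^ 2 ≤ ((1 + 2 * δ) * Real.sin (α / 2)) ^ 2 := by
    gcongr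
  -- Concavity of the sine costs the factor (1 + 2δ)² ≤ 1 + 8δ, which the gain c covers.
  have h7 : (1 + 2 * δ) ^ 2 ≤ 1 + c := by nlinarith
  nlinarith [mul_le_mul_of_nonneg_right h7 (sq_nonneg (Real.sin (α / 2)))]

/-- Short adjacent sides make the geometry nearly flat: 1 - cos A ≥ (15/16)(1 - cos α). With α = 6t
and t ≤ π/6, sin 3t ≥ 1.1 sin 2t makes this at least 1 - cos(2α/3), as 15/16 · 1.1² > 1. -/
theorem euclidCos_le_of_small_sides (h : InscribedChords x y z ρ)
    (hα : Real.cos α = sphericalCos x y z) (hα0 : 0 < α) (hα1 : α < Real.pi)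
    (hy : y ≤ 1 / 2) (hz : z ≤ 1 / 2) {θ : ℝ} (hθ0 : 0 ≤ θ) (hθ : θ ≤ 2 / 3 * α) :
    euclidCos x y z ≤ Real.cos θ := by
  have hy0 := h.pos₂; have hz0 := h.pos₃
  have h1 := h.one_sub_sphericalCos_le
  have h2 : 15 / 16 ≤ √((1 - y ^ 2 / 4) * (1 - z ^ 2 / 4)) := by
    apply Real.le_sqrt_of_sq_le
    have : (15 / 16 : ℝ) ≤ 1 - y ^ 2 / 4 := by nlinarith
    have : (15 / 16 : ℝ) ≤ 1 - z ^ 2 / 4 := by nlinarith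
    nlinarith
  rw [← hα] at h1
  have h3 : 15 / 16 * (1 - Real.cos α) ≤ 1 - euclidCos x y z := by
    nlinarith [Real.cos_le_one α]
  have h4 : Real.cos (2 / 3 * α) ≤ Real.cos θ :=
    Real.cos_le_cos_of_nonneg_of_le_pi hθ0 (by linarith) hθ
  refine le_trans ?_ h4
  obtain ⟨t, rfl⟩ : ∃ t, α = 6 * t := ⟨α / 6, by ring⟩
  have e1 : Real.cos (6 * t) = 1 - 2 * Real.sin (3 * t) ^ 2 := by
    rw [show 6 * t = 2 * (3 * t) by ring, Real.cos_two_mul, Real.cos_sq']; ring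
  have e2 : Real.cos (2 / 3 * (6 * t)) = 1 - 2 * Real.sin (2 * t) ^ 2 := by
    rw [show 2 / 3 * (6 * t) = 2 * (2 * t) by ring, Real.cos_two_mul, Real.cos_sq']; ring
  rw [e1] at h3
  rw [e2]
  have hs : 0 < Real.sin t := Real.sin_pos_of_pos_of_lt_pi (by linarith) (by linarith)
  have hc : √3 / 2 ≤ Real.cos t := by
    rw [← Real.cos_pi_div_six]
    apply Real.cos_le_cos_of_nonneg_of_le_pi <;> linarith
  have h3' : 1.7 ≤ √3 := by
    apply Real.le_sqrt_of_sq_le; norm_num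
  have hs3 : Real.sin (3 * t) = Real.sin t * (4 * Real.cos t ^ 2 - 1) := by
    rw [Real.sin_three_mul]
    have := Real.sin_sq_add_cos_sq t
    linear_combination (-4 * Real.sin t) * this
  have h5 : 1.1 * Real.sin (2 * t) ≤ Real.sin (3 * t) := by
    rw [hs3, Real.sin_two_mul]
    have : 0 ≤ Real.sin t * (4 * Real.cos t ^ 2 - 1 - 2.2 * Real.cos t) := by
      apply mul_nonneg hs.le
      nlinarith
    linarith
  have h6 : 0 ≤ Real.sin (2 * t) :=
    Real.sin_nonneg_of_nonneg_of_le_pi (by linarith) (by linarith)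
  have h7 : (1.1 * Real.sin (2 * t)) ^ 2 ≤ Real.sin (3 * t) ^ 2 := by gcongr
  nlinarith [sq_nonneg (Real.sin (2 * t))]

/-- Here k²√y√z ≥ 25 exceeds the loss of 9 in `one_sub_cos_le`. -/
theorem euclidCos_le_of_small_opposite (h : InscribedChords x y z ρ) (hρ : 1 / 3 ≤ ρ)
    (hα : Real.cos α = sphericalCos x y z) (hx : x ≤ 1 / 100) (hz : 1 / 2 ≤ z) :
    euclidCos (chordDistortion 10 x) (chordDistortion 10 y) (chordDistortion 10 z) ≤
      Real.cos α := by
  have hx0 := h.pos₁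
  have hy : 49 / 100 ≤ y := by linarith [h.lt₃]
  have h9 := h.one_sub_cos_le hρ hα
  rw [chordDistortion_of_le hx0.le (by linarith),
    chordDistortion_of_ge (t := y) (by norm_num) (by linarith) (by linarith),
    chordDistortion_of_ge (t := z) (by norm_num) (by linarith) (by linarith)]
  have hq : 1 / 2 ≤ √y := Real.le_sqrt_of_sq_le (by linarith)
  have hw : 1 / 2 ≤ √z := Real.le_sqrt_of_sq_le (by linarith)
  have h1 := mul_one_sub_euclidCos_le (k := 10) (p := √x) (q := √y) (w := √z) (by norm_num)
    (by linarith) (by linarith) (by linarith)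
  rw [Real.sq_sqrt hx0.le, Real.sq_sqrt (by linarith), Real.sq_sqrt (by linarith)] at h1
  have h2 : 1 / 4 ≤ √y * √z := by nlinarith
  nlinarith [h.euclidCos_lt_one]

/-- Both 100y² and z - x are at most y, so the cosine is at most 1/(10√z). -/
theorem euclidCos_le_of_small_adjacent (h : InscribedChords x y z ρ)
    (hx : 1 / 100 ≤ x) (hy : y ≤ 1 / 100) (hz : 1 / 2 ≤ z) :
    euclidCos (chordDistortion 10 x) (chordDistortion 10 y) (chordDistortion 10 z) ≤ 1 / 5 := by
  have hx0 := h.pos₁; have hy0 := h.pos₂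
  rw [chordDistortion_of_le hy0.le (by linarith),
    chordDistortion_of_ge (t := x) (by norm_num) (by linarith) (by linarith),
    chordDistortion_of_ge (t := z) (by norm_num) (by linarith) (by linarith)]
  have hw : 1 / 2 ≤ √z := Real.le_sqrt_of_sq_le (by linarith)
  unfold euclidCos
  rw [Real.sq_sqrt (by linarith), Real.sq_sqrt (by linarith), div_le_iff₀ (by positivity)]
  nlinarith [h.lt₃, mul_le_mul_of_nonneg_left hw hy0.le]

theorem cos_ge_of_small_adjacent (h : InscribedChords x y z ρ) (hρ : 1 / 3 ≤ ρ)
    (hy : y ≤ 1 / 100) (hA : -(1 / 25) ≤ euclidCos x y z) :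
    -(1 / 2) ≤ sphericalCos x y z := by
  have h1 := h.cos_sq_le_sqrt
  have hy0 := h.pos₂; have hz0 := h.pos₃
  have hz2 : z ≤ 2 := by nlinarith [h.swap.cos_sq_le, sq_nonneg ρ]
  have h2 : 1 / 9 ≤ √((1 - y ^ 2 / 4) * (1 - z ^ 2 / 4)) := by nlinarith
  unfold sphericalCos
  rw [le_div_iff₀ (by linarith)]
  nlinarith

theorem one_sub_two_mul_div_pi_le_cos {θ : ℝ} (h0 : 0 ≤ θ) (h1 : θ ≤ Real.pi / 2) :
    1 - 2 / Real.pi * θ ≤ Real.cos θ := by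
  have h := Real.mul_le_sin (x := Real.pi / 2 - θ) (by linarith) (by linarith)
  rw [Real.sin_pi_div_two_sub] at h
  have hp := Real.pi_pos
  have : 2 / Real.pi * (Real.pi / 2 - θ) = 1 - 2 / Real.pi * θ := by field_simp
  linarith

theorem neg_le_cos_half_add {δ : ℝ} (hδ : 0 < δ) (hδ1 : δ ≤ 1 / 10000) (hα0 : 0 < α)
    (hα1 : α < Real.pi) : -(1 / 25) ≤ Real.cos ((1 / 2 + δ) * α) := by
  have hpi := Real.pi_gt_three
  have hpi' := Real.pi_lt_four
  have h1 : Real.cos (Real.pi / 2 + δ * Real.pi) ≤ Real.cos ((1 / 2 + δ) * α) := by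
    apply Real.cos_le_cos_of_nonneg_of_le_pi (by positivity) <;> nlinarith
  rw [add_comm, Real.cos_add_pi_div_two] at h1
  have h2 := Real.sin_le (x := δ * Real.pi) (by positivity)
  nlinarith

/-- A chord is in the square-root regime from 1/100 on. If x is short, even the whole angle α is
reached. If y is short, A is not much beyond a right angle, which forces α ≤ 2π/3 and cos((1/2 +
δ)α) ≥ 1/5. Otherwise the transformed angle is Q. -/
theorem euclidCos_chordDistortion_le_of_large (h : InscribedChords x y z ρ) (hρ : 1 / 3 ≤ ρ)
    (hα : Real.cos α = sphericalCos x y z) (hα0 : 0 < α) (hα1 : α < Real.pi) {δ : ℝ}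
    (hδ : 0 < δ) (hδ1 : δ ≤ 1 / 10000)
    (hQ : euclidCos √x √y √z ≤ Real.cos ((1 / 2 + δ) * α))
    (hA : Real.cos ((1 / 2 + δ) * α) < euclidCos x y z) (hz : 1 / 2 ≤ z) :
    euclidCos (chordDistortion 10 x) (chordDistortion 10 y) (chordDistortion 10 z) ≤
      Real.cos ((1 / 2 + δ) * α) := by
  have hx0 := h.pos₁; have hy0 := h.pos₂
  have hpi := Real.pi_gt_three
  have hθα : (1 / 2 + δ) * α ≤ α := by nlinarith
  have hθ0 : 0 ≤ (1 / 2 + δ) * α := by positivity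
  rcases le_total x (1 / 100) with hx | hx
  · exact (h.euclidCos_le_of_small_opposite hρ hα hx hz).trans
      (Real.cos_le_cos_of_nonneg_of_le_pi hθ0 hα1.le hθα)
  rcases le_total y (1 / 100) with hy | hy
  · refine (h.euclidCos_le_of_small_adjacent hx hy hz).trans ?_
    have h1 := h.cos_ge_of_small_adjacent hρ hy
      ((neg_le_cos_half_add hδ hδ1 hα0 hα1).trans hA.le)
    rw [← hα] at h1
    have h2 : α ≤ 2 / 3 * Real.pi := by
      by_contra! hc
      have := Real.cos_lt_cos_of_nonneg_of_le_pi (by linarith) hα1.le hc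
      rw [show 2 / 3 * Real.pi = Real.pi - Real.pi / 3 by ring, Real.cos_pi_sub,
        Real.cos_pi_div_three] at this
      linarith
    have h3 : (1 / 2 + δ) * α ≤ 2 / 5 * Real.pi := by nlinarith
    have h4 := one_sub_two_mul_div_pi_le_cos hθ0 (h3.trans (by linarith))
    have h5 : 2 / Real.pi * ((1 / 2 + δ) * α) ≤ 2 / Real.pi * (2 / 5 * Real.pi) := by gcongr
    have h6 : 2 / Real.pi * (2 / 5 * Real.pi) = 4 / 5 := by field_simp; norm_num
    linarith
  · rwa [chordDistortion_of_ge (t := x) (by norm_num) (by linarith) (by linarith),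
      chordDistortion_of_ge (t := y) (by norm_num) (by linarith) (by linarith),
      chordDistortion_of_ge (t := z) (by norm_num) (by linarith) (by linarith)]

theorem exists_angle_bound {ρ₀ : ℝ} (hρ₀ : 1 / 3 < ρ₀) :
    ∃ δ : ℝ, 0 < δ ∧ δ ≤ 1 / 2 ∧ ∀ x y z ρ α : ℝ, InscribedChords x y z ρ → ρ₀ ≤ ρ → 0 < α →
      α < Real.pi → Real.cos α = sphericalCos x y z →
      euclidCos (chordDistortion 10 x) (chordDistortion 10 y) (chordDistortion 10 z) ≤
        Real.cos ((1 / 2 + δ) * α) := by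
  have hs0 : 0 < Real.sin (1 / 2000) :=
    Real.sin_pos_of_pos_of_lt_pi (by norm_num) (by linarith [Real.pi_gt_three])
  -- κ measures how far ρ₀ exceeds the critical value 1/3.
  obtain ⟨κ, hκ, hκ1, hκρ⟩ : ∃ κ : ℝ, 0 < κ ∧ κ ≤ 1 ∧ 1 + κ ≤ 9 * ρ₀ ^ 2 :=
    ⟨min 1 (9 * ρ₀ ^ 2 - 1), lt_min one_pos (by nlinarith), min_le_left _ _,
      by linarith [min_le_right 1 (9 * ρ₀ ^ 2 - 1)]⟩
  obtain ⟨δ, hδ, hδ1, hδκ⟩ : ∃ δ : ℝ, 0 < δ ∧ δ ≤ 1 / 10000 ∧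
      8 * δ ≤ Real.sin (1 / 2000) ^ 2 * κ / 36 := by
    refine ⟨min (1 / 10000) (Real.sin (1 / 2000) ^ 2 * κ / 36 / 8),
      lt_min (by norm_num) (by positivity), min_le_left _ _, ?_⟩
    linarith [min_le_right (1 / 10000) (Real.sin (1 / 2000) ^ 2 * κ / 36 / 8)]
  refine ⟨δ, hδ, by linarith, fun x y z ρ α h hρ hα0 hα1 hα => ?_⟩
  have hx := h.pos₁; have hy := h.pos₂; have hz := h.pos₃
  have hρ3 : 1 / 3 ≤ ρ := by linarith
  have hκρ' : 1 + κ ≤ 9 * ρ ^ 2 := by nlinarith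
  rcases lt_or_ge (Real.pi - 1 / 1000) α with hpi | hpi
  · obtain ⟨hA, hx1, hy1, hz1⟩ := h.of_angle_near_pi hρ3 hα hα1.le hpi
    rw [chordDistortion_of_le hx.le (by linarith), chordDistortion_of_le hy.le (by linarith),
      chordDistortion_of_le hz.le (by linarith), euclidCos_mul (by norm_num)]
    linarith [neg_le_cos_half_add hδ hδ1 hα0 hα1]
  have hQ := h.euclidCos_sqrt_le hκ hκ1 hκρ' hα hα0 hpi hδ hδ1 hδκ
  rcases le_or_gt (euclidCos x y z) (Real.cos ((1 / 2 + δ) * α)) with hA | hA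
  · exact (euclidCos_chordDistortion_le (by norm_num) hx hy hz h.lt₁ h.lt₂ h.lt₃).trans
      (max_le hA hQ)
  rcases le_or_gt (1 / 2) z with hz2 | hz2
  · exact h.euclidCos_chordDistortion_le_of_large hρ3 hα hα0 hα1 hδ hδ1 hQ hA hz2
  rcases le_or_gt (1 / 2) y with hy2 | hy2
  · rw [euclidCos_comm]
    rw [euclidCos_comm] at hQ hA
    rw [sphericalCos_comm] at hα
    exact h.swap.euclidCos_chordDistortion_le_of_large hρ3 hα hα0 hα1 hδ hδ1 hQ hA hy2
  · exact absurd (h.euclidCos_le_of_small_sides hα hα0 hα1 hy2.le hz2.le (by positivity)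
      (by nlinarith)) (not_le.2 hA)

end InscribedChords

/-! ### From spherical triangles to chords. -/

theorem chd_angle {u v : Space3} (hu : ‖u‖ = 1) (hv : ‖v‖ = 1) :
    chd (InnerProductGeometry.angle u v) = dist u v := by
  have h0 := InnerProductGeometry.angle_nonneg u v
  have h1 := InnerProductGeometry.angle_le_pi u v
  have hs : 0 ≤ Real.sin (InnerProductGeometry.angle u v / 2) :=
    Real.sin_nonneg_of_nonneg_of_le_pi (by linarith) (by linarith [Real.pi_pos])
  have hc : inner ℝ u v = Real.cos (InnerProductGeometry.angle u v) := by
    rw [InnerProductGeometry.cos_angle, hu, hv]; simp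
  have h2 : chd (InnerProductGeometry.angle u v) ^ 2 = dist u v ^ 2 := by
    rw [dist_eq_norm, norm_sub_sq_real, hu, hv, hc, chd, mul_pow, Real.sin_sq_eq_half_sub]
    ring_nf
  exact (pow_left_inj₀ (by unfold chd; positivity) dist_nonneg two_ne_zero).1 h2

theorem inner_eq_of_dist {u v : Space3} (hu : ‖u‖ = 1) (hv : ‖v‖ = 1) :
    inner ℝ u v = 1 - dist u v ^ 2 / 2 := by
  rw [dist_eq_norm, norm_sub_sq_real, hu, hv]
  ring

theorem norm_tangentToward {u v : Space3} (hu : ‖u‖ = 1) (hv : ‖v‖ = 1) :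
    ‖tangentToward u v‖ = dist u v * √(1 - dist u v ^ 2 / 4) := by
  have huu : inner ℝ u u = (1 : ℝ) := by rw [real_inner_self_eq_norm_sq, hu]; norm_num
  have hvv : inner ℝ v v = (1 : ℝ) := by rw [real_inner_self_eq_norm_sq, hv]; norm_num
  have h : ‖tangentToward u v‖ ^ 2 = dist u v ^ 2 * (1 - dist u v ^ 2 / 4) := by
    rw [← real_inner_self_eq_norm_sq]
    unfold tangentToward
    simp only [inner_sub_left, inner_sub_right, real_inner_smul_left, real_inner_smul_right,
      huu, hvv, real_inner_comm u v]
    rw [inner_eq_of_dist hu hv]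
    ring
  rw [← Real.sqrt_sq (norm_nonneg (tangentToward u v)), h, Real.sqrt_mul (sq_nonneg _),
    Real.sqrt_sq dist_nonneg]

/-- The spherical law of cosines, written in chords. -/
theorem cos_angle_tangentToward {u v w : Space3} (hu : ‖u‖ = 1) (hv : ‖v‖ = 1) (hw : ‖w‖ = 1)
    (huv : u ≠ v) (hwu : w ≠ u) (h4 : 0 ≤ 1 - dist w u ^ 2 / 4) :
    Real.cos (InnerProductGeometry.angle (tangentToward u v) (tangentToward u w)) =
      sphericalCos (dist v w) (dist w u) (dist u v) := by
  have hy : 0 < dist w u := dist_pos.2 hwu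
  have hz : 0 < dist u v := dist_pos.2 huv
  have huu : inner ℝ u u = (1 : ℝ) := by rw [real_inner_self_eq_norm_sq, hu]; norm_num
  have hin : inner ℝ (tangentToward u v) (tangentToward u w) =
      inner ℝ v w - inner ℝ u v * inner ℝ u w := by
    unfold tangentToward
    simp only [inner_sub_left, inner_sub_right, real_inner_smul_left, real_inner_smul_right, huu]
    rw [real_inner_comm u v]
    ring
  rw [InnerProductGeometry.cos_angle, hin, norm_tangentToward hu hv, norm_tangentToward hu hw,
    inner_eq_of_dist hv hw, inner_eq_of_dist hu hv, inner_eq_of_dist hu hw, dist_comm u w]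
  unfold sphericalCos
  rw [Real.sqrt_mul h4]
  set x := dist v w
  set y := dist w u
  set z := dist u v
  have e : 1 - x ^ 2 / 2 - (1 - z ^ 2 / 2) * (1 - y ^ 2 / 2) =
      (z * y) * (euclidCos x y z - y * z / 4) := by
    unfold euclidCos; field_simp; ring
  rw [e, show z * √(1 - z ^ 2 / 4) * (y * √(1 - y ^ 2 / 4)) =
    (z * y) * (√(1 - y ^ 2 / 4) * √(1 - z ^ 2 / 4)) by ring, mul_div_mul_left _ _ (by positivity)]

/-- The Gram matrix G of u, v, w maps (a, b, c) to ρ(1, 1, 1), and ‖N‖ = 1 gives (a + b + c)ρ = 1.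
Applying the adjugate, det G is ρ² times the sum of the cofactors, and that sum is `heronProd` over
4. -/
theorem heronProd_mul_one_sub_sq {u v w : Space3} (hu : ‖u‖ = 1) (hv : ‖v‖ = 1) (hw : ‖w‖ = 1)
    {ρ a b c : ℝ} {N : Space3} (hN : ‖N‖ = 1) (hNe : N = a • u + b • v + c • w)
    (hNu : inner ℝ N u = ρ) (hNv : inner ℝ N v = ρ) (hNw : inner ℝ N w = ρ) :
    heronProd (dist v w) (dist w u) (dist u v) * (1 - ρ ^ 2) =
      (dist v w * dist w u * dist u v) ^ 2 := by
  have huu : inner ℝ u u = (1 : ℝ) := by rw [real_inner_self_eq_norm_sq, hu]; norm_num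
  have hvv : inner ℝ v v = (1 : ℝ) := by rw [real_inner_self_eq_norm_sq, hv]; norm_num
  have hww : inner ℝ w w = (1 : ℝ) := by rw [real_inner_self_eq_norm_sq, hw]; norm_num
  have hNN : inner ℝ N N = (1 : ℝ) := by rw [real_inner_self_eq_norm_sq, hN]; norm_num
  have e0 : (a + b + c) * ρ = 1 := by
    rw [← hNN]
    nth_rw 2 [hNe]
    simp only [inner_add_right, real_inner_smul_right, hNu, hNv, hNw]
    ring
  have hp := inner_eq_of_dist hv hw
  have hq := inner_eq_of_dist hw hu
  have hr := inner_eq_of_dist hu hv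
  rw [hNe] at hNu hNv hNw
  simp only [inner_add_left, real_inner_smul_left, huu, hvv, hww, real_inner_comm u v,
    real_inner_comm v w, real_inner_comm w u] at hNu hNv hNw
  unfold heronProd
  generalize (inner ℝ v w : ℝ) = p at *
  generalize (inner ℝ w u : ℝ) = q at *
  generalize (inner ℝ u v : ℝ) = r at *
  have h1 : (1 + 2 * p * q * r - p ^ 2 - q ^ 2 - r ^ 2) * (a + b + c) =
      ρ * ((1 - p ^ 2) + (1 - q ^ 2) + (1 - r ^ 2) + 2 * (p * q - r) + 2 * (q * r - p) +
        2 * (r * p - q)) := by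
    linear_combination ((1 - p ^ 2) + (p * q - r) + (p * r - q)) * hNu +
      ((1 - q ^ 2) + (p * q - r) + (q * r - p)) * hNv +
      ((1 - r ^ 2) + (p * r - q) + (q * r - p)) * hNw
  have h2 : 1 + 2 * p * q * r - p ^ 2 - q ^ 2 - r ^ 2 =
      ρ ^ 2 * ((1 - p ^ 2) + (1 - q ^ 2) + (1 - r ^ 2) + 2 * (p * q - r) + 2 * (q * r - p) +
        2 * (r * p - q)) := by
    linear_combination ρ * h1 - (1 + 2 * p * q * r - p ^ 2 - q ^ 2 - r ^ 2) * e0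
  rw [hp, hq, hr] at h2
  linear_combination 4 * h2

namespace SphericalTriangle

variable (Δ : SphericalTriangle)

theorem eq_zero_of_sum_eq_zero (i : Fin 3) {a b c : ℝ}
    (h : a • Δ.vertex i + b • Δ.vertex (i + 1) + c • Δ.vertex (i + 2) = 0) :
    a = 0 ∧ b = 0 ∧ c = 0 := by
  have key := Fintype.linearIndependent_iff.1 Δ.linearIndependent
  fin_cases i
  · have := key ![a, b, c] (by simpa [Fin.sum_univ_three] using h)
    exact ⟨this 0, this 1, this 2⟩
  · have := key ![c, a, b] (by
      simp [Fin.sum_univ_three] at h ⊢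
      rw [← h]; abel)
    exact ⟨this 1, this 2, this 0⟩
  · have := key ![b, c, a] (by
      simp [Fin.sum_univ_three] at h ⊢
      rw [← h]; abel)
    exact ⟨this 2, this 0, this 1⟩

theorem exists_eq_sum (i : Fin 3) (N : Space3) : ∃ a b c : ℝ,
    N = a • Δ.vertex i + b • Δ.vertex (i + 1) + c • Δ.vertex (i + 2) := by
  let b := basisOfLinearIndependentOfCardEqFinrank Δ.linearIndependent (by simp)
  have hb : ∀ i, b i = Δ.vertex i := fun i => by simp [b]
  have h := (b.sum_repr N).symm
  simp only [hb, Fin.sum_univ_three] at h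
  fin_cases i
  · exact ⟨_, _, _, h⟩
  · refine ⟨b.repr N 1, b.repr N 2, b.repr N 0, ?_⟩
    nth_rw 1 [h]
    simp
    abel
  · refine ⟨b.repr N 2, b.repr N 0, b.repr N 1, ?_⟩
    nth_rw 1 [h]
    simp
    abel

/-- Equality would put one vertex on the segment between the others, against linear independence. -/
theorem dist_vertex_lt (i : Fin 3) : dist (Δ.vertex (i + 1)) (Δ.vertex (i + 2)) <
    dist (Δ.vertex (i + 2)) (Δ.vertex i) + dist (Δ.vertex i) (Δ.vertex (i + 1)) := by
  refine lt_of_le_of_ne ?_ fun h => ?_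
  · rw [dist_comm]
    exact dist_triangle _ _ _
  · rw [dist_comm (Δ.vertex (i + 1)), eq_comm, dist_add_dist_eq_iff] at h
    obtain ⟨t, -, ht⟩ := h
    rw [AffineMap.lineMap_apply_module] at ht
    have := (Δ.eq_zero_of_sum_eq_zero i (a := -1) (b := t) (c := 1 - t) (by rw [← ht]; module)).1
    norm_num at this

theorem chd_side (i : Fin 3) :
    chd (Δ.side i) = dist (Δ.vertex (i + 1)) (Δ.vertex (i + 2)) :=
  chd_angle (Δ.norm_vertex _) (Δ.norm_vertex _)

theorem chd_side_add_one (i : Fin 3) :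
    chd (Δ.side (i + 1)) = dist (Δ.vertex (i + 2)) (Δ.vertex i) := by
  rw [chd_side]
  fin_cases i <;> rfl

theorem chd_side_add_two (i : Fin 3) :
    chd (Δ.side (i + 2)) = dist (Δ.vertex i) (Δ.vertex (i + 1)) := by
  rw [chd_side]
  fin_cases i <;> rfl

theorem chd_side_lt (i : Fin 3) :
    chd (Δ.side i) < chd (Δ.side (i + 1)) + chd (Δ.side (i + 2)) := by
  rw [chd_side_add_one, chd_side_add_two, chd_side]
  exact Δ.dist_vertex_lt i

theorem chd_side_pos (i : Fin 3) : 0 < chd (Δ.side i) := by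
  rw [chd_side, dist_pos]
  intro h
  have := Δ.linearIndependent.injective h
  revert this
  fin_cases i <;> decide

theorem inscribedChords {R : ℝ} (hR : Δ.IsCircumradius R) (hpos : 0 < Real.cos R) (i : Fin 3) :
    InscribedChords (chd (Δ.side i)) (chd (Δ.side (i + 1))) (chd (Δ.side (i + 2)))
      (Real.cos R) := by
  refine ⟨Δ.chd_side_pos _, Δ.chd_side_pos _, Δ.chd_side_pos _, Δ.chd_side_lt i, ?_, ?_, hpos, ?_⟩
  · have := Δ.chd_side_lt (i + 1)
    rwa [(by decide : ∀ j : Fin 3, j + 1 + 1 = j + 2) i,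
      (by decide : ∀ j : Fin 3, j + 1 + 2 = j) i] at this
  · have := Δ.chd_side_lt (i + 2)
    rwa [(by decide : ∀ j : Fin 3, j + 2 + 1 = j) i,
      (by decide : ∀ j : Fin 3, j + 2 + 2 = j + 1) i] at this
  · obtain ⟨N, hN, hv, -⟩ := hR
    have hin : ∀ i, inner ℝ N (Δ.vertex i) = Real.cos R := fun i => by
      rw [← hv i, InnerProductGeometry.cos_angle, hN, Δ.norm_vertex]; simp
    obtain ⟨a, b, c, hNe⟩ := Δ.exists_eq_sum i N
    rw [chd_side_add_one, chd_side_add_two, chd_side]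
    exact heronProd_mul_one_sub_sq (Δ.norm_vertex _) (Δ.norm_vertex _) (Δ.norm_vertex _) hN hNe
      (hin _) (hin _) (hin _)

theorem cos_angle_eq {R : ℝ} (hR : Δ.IsCircumradius R) (hpos : 0 < Real.cos R) (i : Fin 3) :
    Real.cos (Δ.angle i) =
      sphericalCos (chd (Δ.side i)) (chd (Δ.side (i + 1))) (chd (Δ.side (i + 2))) := by
  have h := Δ.inscribedChords hR hpos i
  have h1 := h.cos_sq_le
  have hy := h.pos₂
  have hz := h.pos₃
  rw [chd_side_add_one] at h1 hy
  rw [chd_side_add_two] at hz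
  rw [chd_side_add_one, chd_side_add_two, chd_side]
  exact cos_angle_tangentToward (Δ.norm_vertex _) (Δ.norm_vertex _) (Δ.norm_vertex _)
    (dist_pos.1 hz) (dist_pos.1 hy) ((sq_nonneg _).trans h1)

end SphericalTriangle

/-! ### Euclidean triangles with given sides. -/

namespace EuclideanTriangle

theorem cos_angle_eq (T : EuclideanTriangle) (i : Fin 3) (h1 : 0 < T.side (i + 1))
    (h2 : 0 < T.side (i + 2)) :
    Real.cos (T.angle i) = euclidCos (T.side i) (T.side (i + 1)) (T.side (i + 2)) := by
  have e1 : T.side (i + 1) = dist (T.points (i + 2)) (T.points i) := by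
    unfold side; fin_cases i <;> rfl
  have e2 : T.side (i + 2) = dist (T.points (i + 1)) (T.points i) := by
    rw [dist_comm]; unfold side; fin_cases i <;> rfl
  have h := EuclideanGeometry.law_cos (T.points (i + 1)) (T.points i) (T.points (i + 2))
  rw [← e1, ← e2] at h
  change T.side i * T.side i = _ + _ - _ * Real.cos (T.angle i) at h
  unfold euclidCos
  rw [eq_div_iff (by positivity)]
  linear_combination h

theorem exists_of_sides {s : Fin 3 → ℝ} (hs : ∀ i, 0 < s i)
    (hlt : ∀ i, s i < s (i + 1) + s (i + 2)) : ∃ T : EuclideanTriangle, ∀ i, T.side i = s i := by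
  -- With side 2 on the first axis, X is the abscissa of the third vertex, by the law of cosines.
  obtain ⟨X, hX⟩ : ∃ X, X = (s 1 ^ 2 + s 2 ^ 2 - s 0 ^ 2) / (2 * s 2) := ⟨_, rfl⟩
  have h0 := hs 0; have h1 := hs 1; have h2 := hs 2
  have l0 : s 0 < s 1 + s 2 := hlt 0
  have l1 : s 1 < s 2 + s 0 := hlt 1
  have l2 : s 2 < s 0 + s 1 := hlt 2
  have hX' : 2 * s 2 * X = s 1 ^ 2 + s 2 ^ 2 - s 0 ^ 2 := by rw [hX]; field_simp
  have hX1 : X ^ 2 ≤ s 1 ^ 2 := by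
    apply sq_le_sq'
    · nlinarith
    · nlinarith
  have hY := Real.sq_sqrt (sub_nonneg.2 hX1)
  let P : Fin 3 → EuclideanSpace ℝ (Fin 2) := ![!₂[0, 0], !₂[s 2, 0], !₂[X, √(s 1 ^ 2 - X ^ 2)]]
  have d0 : dist (P 1) (P 2) = s 0 := by
    rw [EuclideanSpace.dist_eq, Real.sqrt_eq_iff_mul_self_eq (by positivity) h0.le]
    simp [P, Fin.sum_univ_two, Real.dist_eq]
    linarith
  have d1 : dist (P 2) (P 0) = s 1 := by
    rw [EuclideanSpace.dist_eq, Real.sqrt_eq_iff_mul_self_eq (by positivity) h1.le]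
    simp [P, Fin.sum_univ_two, Real.dist_eq]
    linarith
  have d2 : dist (P 0) (P 1) = s 2 := by
    rw [EuclideanSpace.dist_eq, Real.sqrt_eq_iff_mul_self_eq (by positivity) h2.le]
    simp [P, Fin.sum_univ_two, Real.dist_eq]
    ring
  have hP : AffineIndependent ℝ P := by
    have : P = ![P 0, P 1, P 2] := by ext i; fin_cases i <;> rfl
    rw [this, affineIndependent_iff_not_collinear_set]
    intro hc
    rcases hc.wbtw_or_wbtw_or_wbtw with h | h | h
    · have := h.dist_add_dist
      rw [dist_comm (P 0) (P 2)] at this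
      linarith
    · have := h.dist_add_dist
      rw [dist_comm (P 1) (P 0)] at this
      linarith
    · have := h.dist_add_dist
      rw [dist_comm (P 2) (P 1)] at this
      linarith
  refine ⟨⟨P, hP⟩, fun i => ?_⟩
  fin_cases i
  · exact d0
  · exact d1
  · exact d2

end EuclideanTriangle

/-! ### Conclusion. -/

theorem cos_b₀ : Real.cos b₀ = 1 / 3 := by
  rw [b₀, Real.cos_arctan, Real.sq_sqrt (by norm_num), show (1 + 8 : ℝ) = 3 ^ 2 by norm_num,
    Real.sqrt_sq (by norm_num)]

theorem SphericalTriangle.IsCircumradius.nonneg {Δ : SphericalTriangle} {R : ℝ}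
    (h : Δ.IsCircumradius R) : 0 ≤ R := by
  obtain ⟨N, -, hv, -⟩ := h
  rw [← hv 0]
  exact InnerProductGeometry.angle_nonneg _ _

theorem theorem1p5 (ε : ℝ) (hε : ε ∈ Set.Ioo 0 b₀) :
    ∃ k : ℝ, 1 ≤ k ∧ ∃ δ : ℝ, 0 < δ ∧
      ∀ Δ : SphericalTriangle, Δ.circumradius ≤ b₀ - ε →
        (∃ T : EuclideanTriangle, IsTransformedTriangle (sideDistortion k) Δ T) ∧
        ∀ T : EuclideanTriangle, IsTransformedTriangle (sideDistortion k) Δ T →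
          1 / 2 + δ ≤ angleDistortion Δ T := by
  have hb : b₀ ≤ Real.pi := by
    have := Real.arctan_lt_pi_div_two (√8)
    unfold b₀
    linarith [Real.pi_pos]
  have hρ₀ : 1 / 3 < Real.cos (b₀ - ε) := by
    rw [← cos_b₀]
    exact Real.cos_lt_cos_of_nonneg_of_le_pi (by linarith [hε.2]) hb (by linarith [hε.1])
  obtain ⟨δ, hδ, hδ1, hmain⟩ := InscribedChords.exists_angle_bound hρ₀
  refine ⟨10, by norm_num, δ, hδ, fun Δ hΔ => ⟨?_, fun T hT => ?_⟩⟩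
  · exact EuclideanTriangle.exists_of_sides
      (fun i => chordDistortion_pos (by norm_num) (Δ.chd_side_pos i))
      (fun i => chordDistortion_triangle (by norm_num) (Δ.chd_side_pos _) (Δ.chd_side_pos _)
        (Δ.chd_side_pos _) (Δ.chd_side_lt i))
  · have hR := (Δ.isCircumradius_iff _).2 rfl
    have hcos : Real.cos (b₀ - ε) ≤ Real.cos Δ.circumradius :=
      Real.cos_le_cos_of_nonneg_of_le_pi hR.nonneg (by linarith [hε.1]) hΔ
    have hpos : 0 < Real.cos Δ.circumradius := by linarith
    have hT' : ∀ i, T.side i = chordDistortion 10 (chd (Δ.side i)) := hT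
    have hside : ∀ i, 0 < T.side i := fun i => by
      rw [hT']; exact chordDistortion_pos (by norm_num) (Δ.chd_side_pos i)
    have key : ∀ i, 1 / 2 + δ ≤ T.angle i / Δ.angle i := fun i => by
      obtain ⟨h0, h1⟩ := Δ.angle_mem_Ioo i
      rw [le_div_iff₀ h0]
      have h := hmain _ _ _ _ _ (Δ.inscribedChords hR hpos i) hcos h0 h1 (Δ.cos_angle_eq hR hpos i)
      rw [← hT', ← hT', ← hT', ← T.cos_angle_eq i (hside _) (hside _)] at h
      by_contra! hlt
      refine absurd h (not_le.2 (Real.cos_lt_cos_of_nonneg_of_le_pi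
        (EuclideanGeometry.angle_nonneg _ _ _) ?_ hlt))
      -- δ ≤ 1/2 keeps (1/2 + δ)α within [0, π], where the cosine decreases.
      nlinarith
    exact le_min (key 0) (le_min (key 1) (key 2))
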